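/- Permutations are orderings $\pi=\pi_1\cdots\pi_n$ of finite sets of positive integers, written in one-line notation; $S_n$ is the set of permutations of $\{1,\ldots,n\}$. Let $\mathrm{des}(\pi)$ be the number of $i\in\{1,\ldots,n-1\}$ with $\pi_i>\pi_{i+1}$, and $\mathrm{peak}(\pi)$ the number of $i\in\{2,\ldots,n-1\}$ with $\pi_{i-1}<\pi_i>\pi_{i+1}$. The (West) stack-sorting map $s$ sends $\pi$ to the output of the following procedure: at each step, if the stack is empty or the next input entry is smaller than the entry at the top of the stack, push the next input entry onto the stack; otherwise (also if no input is left) move the top entry of the stack to the end of the output; stop when the output has length $n$. Let $\mathcal W_t(n)$ be the set of $\pi\in S_n$ such that $s^t(\pi)$ is increasing. For $\pi\in S_n$, let the tail length $\mathrm{tl}(\pi)$ be the smallest integer $k\ge 0$ such that $\pi_{n-k}\neq n-k$, with $\mathrm{tl}(12\cdots n)=n$, and let $\mathrm{leg}(\pi)$ be the number of $a\in\{0,\ldots,n\}$ for which there are no indices $i_1<i_2<i_3$ with $\pi_{i_3}\le a<\pi_{i_1}<\pi_{i_2}$. For integers $g,\ell,n\ge 0$ put \[\mathcal D_{\ge\ell}^{(g)}(n)=\{\pi\in\mathcal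 W_2(n+\ell):\mathrm{tl}(\pi)\ge\ell,\ \mathrm{leg}(\pi)=\ell+g\},\qquad E_{\ge\ell}^{(g)}(n)=\sum_{\sigma\in s^{-1}(\mathcal D_{\ge\ell}^{(g)}(n))}x^{\mathrm{des}(\sigma)+1}y^{\mathrm{peak}(\sigma)+1}.\] Let $L_r(x,y)=\sum_{i=1}^r\sum_{j=1}^r L(r,i,j)x^iy^j$, where $L(r,i,j)$ is the number of binary plane trees with $r$ vertices, $i-1$ right edges and $j$ leaves. Theorem. If $n\ge 1$, then \[\sum_{\sigma\in\mathcal W_3(n)}x^{\mathrm{des}(\sigma)+1}y^{\mathrm{peak}(\sigma)+1}=\sum_{g=1}^{n+1}E_{\ge 0}^{(g)}(n),\] where the polynomials $E_{\ge\ell}^{(g)}(n)$ satisfy the following relations. For all $\ell,n\ge 0$ we have $E_{\ge\ell}^{(0)}(n)=0$. For all $g,\ell\ge 0$ we have $E_{\ge\ell}^{(g)}(1)=L_{\ell+1}(x,y)$ if $g=2$, and $E_{\ge\ell}^{(g)}(1)=0$ if $g\ne 2$. If $n,g\ge 1$ and $\ell\ge 0$, then \[E_{\ge\ell}^{(g)}(n+1)=\sum_{j=1}^{\ell}\left(\sum_{a=2}^{n}\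 \sum_{b=\max\{2,g-a\}}^{g-1}\ \sum_{i=a-1}^{n-b+1}E_{\ge j-1}^{(a)}(i)\,E_{\ge\ell-j+1}^{(b)}(n-i)+E_{\ge j-1}^{(g-1)}(n)\,L_{\ell-j+1}(x,y)\right)+E_{\ge\ell+1}^{(g-1)}(n),\] where a sum whose lower limit exceeds its upper limit is $0$. -/

import Mathlib

namespace StackSorting

/-- One run of the stack-sorting procedure: `stackRun input stack` is the word that is still
written to the output when the remaining input is `input` and the stack holds `stack`
(top entry first). The next input entry is pushed if the stack is empty or if that entry is
smaller than the top of the stack; otherwise the top of the stack is moved to the output. -/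
def stackRun : List ℕ → List ℕ → List ℕ
  | [], [] => []
  | [], t :: st => t :: stackRun [] st
  | x :: inp, [] => stackRun inp [x]
  | x :: inp, t :: st =>
      if x < t then stackRun inp (x :: t :: st) else t :: stackRun (x :: inp) st
termination_by inp st => 2 * inp.length + st.length

/-- The stack-sorting map `s`, on words in one-line notation. -/
def stackSort (π : List ℕ) : List ℕ := stackRun π []

theorem stackRun_perm (inp st : List ℕ) : (stackRun inp st).Perm (inp ++ st) := by
  fun_induction stackRun inp st with
  | case1 => simp
  | case2 t st ih => simpa using ih
  | case3 x inp ih =>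
      exact ih.trans (by simp)
  | case4 x inp t st h ih =>
      exact ih.trans List.perm_middle
  | case5 x inp t st h ih =>
      exact (ih.cons t).trans List.perm_middle.symm

/-- The map `s` only rearranges the entries. -/
theorem stackSort_perm (π : List ℕ) : (stackSort π).Perm π := by
  simpa [stackSort] using stackRun_perm π []

/-- `S_n`: the permutations of `{1, …, n}` in one-line notation. -/
def permsOf (n : ℕ) : Finset (List ℕ) := (List.range' 1 n).permutations.toFinset

theorem mem_permsOf {n : ℕ} {π : List ℕ} : π ∈ permsOf n ↔ π.Perm (List.range' 1 n) := by
  simp [permsOf, List.mem_permutations]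

/-- The number of descents: adjacent entries `a b` with `a > b`. -/
def des : List ℕ → ℕ
  | a :: b :: l => (if b < a then 1 else 0) + des (b :: l)
  | _ => 0

/-- The number of peaks: consecutive entries `a b c` with `a < b > c`. -/
def peak : List ℕ → ℕ
  | a :: b :: c :: l => (if a < b ∧ c < b then 1 else 0) + peak (b :: c :: l)
  | _ => 0

/-- `𝒲_t(n)`: the permutations `π ∈ S_n` such that `s^t(π)` is increasing. -/
def sortable (t n : ℕ) : Finset (List ℕ) :=
  (permsOf n).filter fun π => (stackSort^[t] π).Pairwise (· < ·)

/-- The tail length of `π ∈ S_n`: the smallest `k ≥ 0` with `π_{n-k} ≠ n - k`, and `n` if there is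
no such `k < n`. (Positions of lists start at `0`, so `π_{n-k}` sits at position `n - k - 1`.) -/
def tailLength (π : List ℕ) : ℕ :=
  Nat.find (p := fun k => π.length ≤ k ∨ π.getD (π.length - k - 1) 0 ≠ π.length - k)
    ⟨π.length, Or.inl le_rfl⟩

/-- The open interval `(a, a+1)` is a legal space for `π`: there are no positions
`i₁ < i₂ < i₃` with `π_{i₃} ≤ a < π_{i₁} < π_{i₂}`. -/
def IsLegalSpace (π : List ℕ) (a : ℕ) : Prop :=
  ¬ ∃ i₁ i₂ i₃ : Fin π.length, i₁ < i₂ ∧ i₂ < i₃ ∧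
    π.get i₃ ≤ a ∧ a < π.get i₁ ∧ π.get i₁ < π.get i₂

instance (π : List ℕ) : DecidablePred (IsLegalSpace π) :=
  fun a => by unfold IsLegalSpace; infer_instance

/-- `leg(π)`: the number of `a ∈ {0, …, n}` such that `(a, a+1)` is a legal space for `π`. -/
def leg (π : List ℕ) : ℕ := ((Finset.range (π.length + 1)).filter (IsLegalSpace π)).card

/-- `𝒟_{≥ℓ}^{(g)}(n)`: the `π ∈ 𝒲₂(n+ℓ)` with `tl(π) ≥ ℓ` and `leg(π) = ℓ + g`. -/
def setD (g ℓ n : ℕ) : Finset (List ℕ) :=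
  (sortable 2 (n + ℓ)).filter fun π => ℓ ≤ tailLength π ∧ leg π = ℓ + g

/-- `s⁻¹(𝒟_{≥ℓ}^{(g)}(n))`. -/
def preimageD (g ℓ n : ℕ) : Finset (List ℕ) :=
  (permsOf (n + ℓ)).filter fun σ => stackSort σ ∈ setD g ℓ n

/-- Restricting to `S_{n+ℓ}` loses nothing: `preimageD` is the full preimage under `s`. -/
theorem mem_preimageD {g ℓ n : ℕ} {σ : List ℕ} :
    σ ∈ preimageD g ℓ n ↔ stackSort σ ∈ setD g ℓ n := by
  refine ⟨fun h => (Finset.mem_filter.1 h).2, fun h => Finset.mem_filter.2 ⟨?_, h⟩⟩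
  have h1 := mem_permsOf.1 (Finset.mem_filter.1 (Finset.mem_filter.1 h).1).1
  exact mem_permsOf.2 ((stackSort_perm σ).symm.trans h1)

/-- The number of right edges of a binary plane tree (`nil` is the empty tree, and the vertices
are the `node`s). -/
def rightEdges : BinaryTree Unit → ℕ
  | .nil => 0
  | .node _ l r => rightEdges l + rightEdges r + (if r = .nil then 0 else 1)

/-- The number of leaves, i.e. vertices without children. -/
def leaves : BinaryTree Unit → ℕ
  | .nil => 0
  | .node _ l r => leaves l + leaves r + (if l = .nil ∧ r = .nil then 1 else 0)

/-- `L(r,i,j)`: the number of binary plane trees with `r` vertices, `i - 1` right edges and `j`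
leaves. -/
def numTrees (r i j : ℕ) : ℕ :=
  ((BinaryTree.treesOfNumNodesEq r).filter fun T => rightEdges T + 1 = i ∧ leaves T = j).card

noncomputable section

open MvPolynomial

/-- The monomial `x^{des(σ)+1} y^{peak(σ)+1}`, where `x = X 0` and `y = X 1`. -/
def weight (σ : List ℕ) : MvPolynomial (Fin 2) ℤ := X 0 ^ (des σ + 1) * X 1 ^ (peak σ + 1)

/-- `E_{≥ℓ}^{(g)}(n)`. -/
def polyE (g ℓ n : ℕ) : MvPolynomial (Fin 2) ℤ := ∑ σ ∈ preimageD g ℓ n, weight σ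

/-- `L_r(x,y)`. -/
def polyL (r : ℕ) : MvPolynomial (Fin 2) ℤ :=
  ∑ i ∈ Finset.Icc 1 r, ∑ j ∈ Finset.Icc 1 r, (numTrees r i j : MvPolynomial (Fin 2) ℤ) *
    (X 0 ^ i * X 1 ^ j)

end

end StackSorting

open StackSorting

namespace StackSorting

/-! ### The stack-sorting map and the largest entry -/

/-! If M is the largest entry of LMR, then s(LMR) = s(L)s(R)M. Everything follows from this
identity, used in two ways.

Forwards, it describes 𝒲₂. A word is in 𝒲₂ exactly when its image under s avoids 231
(`pairwise_stackSort_stackSort`). For A(n+1)B with A and B nonempty, s(A) ends in max A, so all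
other entries of A lie below B. Hence A and B are given by their patterns α and β and by the number
c of entries of B below max A. The remaining condition is that c be a legal space of β
(`twiceSortable_merge`, `exists_eq_merge`). The legal spaces of the whole number leg α plus the
legal spaces of β that are at least c (`leg_merge`). As c runs through the legal spaces of β, this
total therefore takes each value from leg α + 1 to leg α + leg β exactly once. With a = leg β and b
= leg α, these are the limits of the sum over b.

Backwards, it computes the fertility F(w), the sum of the weights of the preimages of w: the
preimages of wM are the words LMR with s(L)s(R) = w (`fertility_append_max`). From this comes the
decomposition at a descent top m: if T lists in increasing order the entries above m and these end
the word, then F(AmBT) is the sum of F(Bp)F(Amq) over T = ptq (`fertility_decomposition`).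
Increasing words have fertility L_r, since their preimages obey the recursion of binary plane trees
at the root (`fertility_range'`).

A tail of length ℓ adds ℓ legal spaces and does not affect membership in 𝒲₂. So E_{≥ℓ}^{(g)}(n) is
the sum of F(w (n+1)⋯(n+ℓ)) over w ∈ 𝒲₂(n) with leg w = g (`polyE_eq_sum_fertility`). In the
recursion, n+1 in last position lengthens the tail, n+1 in first position gives the products with L,
and n+1 inside gives the products of two E's. The first identity sorts 𝒲₃(n) by leg(s(σ)). -/

theorem stackRun_append_cons {M : ℕ} (R : List ℕ) (L st : List ℕ) (hL : ∀ x ∈ L, x < M)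
    (hst : ∀ x ∈ st, x < M) :
    stackRun (L ++ M :: R) st = stackRun L st ++ stackRun R [M] := by
  fun_induction stackRun L st with
  | case1 => simp [stackRun]
  | case2 t st ih =>
      have ht : ¬ M < t := by have := hst t (by simp); omega
      have := ih hL fun x hx => hst x (by simp [hx])
      simp only [List.nil_append] at this
      simp [stackRun, ht, this]
  | case3 x inp ih =>
      have := ih (fun y hy => hL y (by simp [hy])) (by simpa using hL x (by simp))
      simpa [stackRun] using this
  | case4 x inp t st h ih =>
      have := ih (fun y hy => hL y (by simp [hy]))
        (by simpa using ⟨hL x (by simp), by simpa using hst⟩)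
      simpa [stackRun, h] using this
  | case5 x inp t st h ih =>
      have := ih hL fun y hy => hst y (by simp [hy])
      simp only [List.cons_append] at this
      simp [stackRun, h, this]

theorem stackRun_append_bottom {M : ℕ} (R st : List ℕ) (hR : ∀ x ∈ R, x < M) :
    stackRun R (st ++ [M]) = stackRun R st ++ [M] := by
  fun_induction stackRun R st with
  | case1 => simp [stackRun]
  | case2 t st ih => simpa [stackRun] using ih hR
  | case3 x inp ih =>
      have := ih fun y hy => hR y (by simp [hy])
      simpa [stackRun, hR x (by simp)] using this
  | case4 x inp t st h ih =>
      have := ih fun y hy => hR y (by simp [hy])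
      simpa [stackRun, h] using this
  | case5 x inp t st h ih => simpa [stackRun, h] using ih hR

theorem stackSort_append_cons {M : ℕ} {L R : List ℕ} (hL : ∀ x ∈ L, x < M)
    (hR : ∀ x ∈ R, x < M) :
    stackSort (L ++ M :: R) = stackSort L ++ stackSort R ++ [M] := by
  have := stackRun_append_bottom R [] hR
  simp only [List.nil_append] at this
  simp [stackSort, stackRun_append_cons R L [] hL (by simp), this]

@[simp] theorem stackSort_nil : stackSort [] = [] := by simp [stackSort, stackRun]

theorem mem_stackSort {w : List ℕ} {x : ℕ} : x ∈ stackSort w ↔ x ∈ w :=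
  (stackSort_perm w).mem_iff

theorem nodup_stackSort {w : List ℕ} : (stackSort w).Nodup ↔ w.Nodup :=
  (stackSort_perm w).nodup_iff

theorem exists_eq_append_max {w : List ℕ} (hw : w ≠ []) (hn : w.Nodup) :
    ∃ L M R, w = L ++ M :: R ∧ (∀ x ∈ L, x < M) ∧ (∀ x ∈ R, x < M) := by
  obtain ⟨M, hM, hmax⟩ := w.toFinset.exists_max_image id (by simpa using hw)
  simp only [List.mem_toFinset, id] at hM hmax
  obtain ⟨L, R, rfl⟩ := List.append_of_mem hM
  have hn' : M ∉ L ∧ M ∉ R := by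
    rw [List.nodup_middle, List.nodup_cons] at hn
    simpa using hn.1
  refine ⟨L, M, R, rfl, fun x hx => ?_, fun x hx => ?_⟩
  · exact lt_of_le_of_ne (hmax x (by simp [hx])) (by rintro rfl; exact hn'.1 hx)
  · exact lt_of_le_of_ne (hmax x (by simp [hx])) (by rintro rfl; exact hn'.2 hx)

/-- Induction on words with distinct entries, splitting at the largest entry. -/
theorem max_induction {p : List ℕ → Prop} (nil : p [])
    (node : ∀ L M R, (∀ x ∈ L, x < M) → (∀ x ∈ R, x < M) → L.Nodup → R.Nodup →
      p L → p R → p (L ++ M :: R)) (w : List ℕ) (hn : w.Nodup) : p w := by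
  induction h : w.length using Nat.strong_induction_on generalizing w with
  | _ r ih =>
    subst h
    by_cases hw : w = []
    · exact hw ▸ nil
    obtain ⟨L, M, R, rfl, hL, hR⟩ := exists_eq_append_max hw hn
    have hLn : L.Nodup := hn.sublist (List.sublist_append_left _ _)
    have hRn : R.Nodup :=
      hn.sublist ((List.sublist_cons_self M R).trans (List.sublist_append_right L _))
    exact node L M R hL hR hLn hRn (ih _ (by simp) L hLn rfl) (ih _ (by simp; omega) R hRn rfl)

theorem stackSort_map {f : ℕ → ℕ} (hf : StrictMono f) (w : List ℕ) :
    stackSort (w.map f) = (stackSort w).map f := by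
  suffices h : ∀ inp st, stackRun (inp.map f) (st.map f) = (stackRun inp st).map f from h w []
  intro inp st
  fun_induction stackRun inp st with
  | case1 => simp [stackRun]
  | case2 t st ih => simpa [stackRun] using ih
  | case3 x inp ih => simpa [stackRun] using ih
  | case4 x inp t st h ih => simpa [stackRun, h, hf.lt_iff_lt] using ih
  | case5 x inp t st h ih => simpa [stackRun, h, hf.lt_iff_lt] using ih

/-! ### Patterns -/

theorem pair_sublist_append {y z : ℕ} {u v : List ℕ} :
    [y, z].Sublist (u ++ v) ↔ [y, z].Sublist u ∨ (y ∈ u ∧ z ∈ v) ∨ [y, z].Sublist v := by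
  rw [List.sublist_append_iff]
  constructor
  · rintro ⟨l₁, l₂, h, h₁, h₂⟩
    rcases l₁ with _ | ⟨a, _ | ⟨b, l⟩⟩ <;> simp at h
    · subst h; exact Or.inr (Or.inr h₂)
    · obtain ⟨rfl, rfl⟩ := h
      exact Or.inr (Or.inl ⟨by simpa using h₁, by simpa using h₂⟩)
    · obtain ⟨rfl, rfl, rfl, rfl⟩ := h; exact Or.inl h₁
  · rintro (h | ⟨h₁, h₂⟩ | h)
    · exact ⟨[y, z], [], rfl, h, by simp⟩
    · exact ⟨[y], [z], rfl, by simpa using h₁, by simpa using h₂⟩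
    · exact ⟨[], [y, z], rfl, by simp, h⟩

theorem triple_sublist_append {y c z : ℕ} {u v : List ℕ} :
    [y, c, z].Sublist (u ++ v) ↔ [y, c, z].Sublist u ∨ ([y, c].Sublist u ∧ z ∈ v) ∨
      (y ∈ u ∧ [c, z].Sublist v) ∨ [y, c, z].Sublist v := by
  rw [List.sublist_append_iff]
  constructor
  · rintro ⟨l₁, l₂, h, h₁, h₂⟩
    rcases l₁ with _ | ⟨a, _ | ⟨b, _ | ⟨d, l⟩⟩⟩ <;> simp at h
    · subst h; exact Or.inr (Or.inr (Or.inr h₂))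
    · obtain ⟨rfl, rfl⟩ := h
      exact Or.inr (Or.inr (Or.inl ⟨by simpa using h₁, h₂⟩))
    · obtain ⟨rfl, rfl, rfl⟩ := h
      exact Or.inr (Or.inl ⟨h₁, by simpa using h₂⟩)
    · obtain ⟨rfl, rfl, rfl, rfl, rfl⟩ := h; exact Or.inl h₁
  · rintro (h | ⟨h₁, h₂⟩ | ⟨h₁, h₂⟩ | h)
    · exact ⟨[y, c, z], [], rfl, h, by simp⟩
    · exact ⟨[y, c], [z], rfl, h₁, by simpa using h₂⟩
    · exact ⟨[y], [c, z], rfl, by simpa using h₁, h₂⟩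
    · exact ⟨[], [y, c, z], rfl, by simp, h⟩

/-- `y` stands left of `z` in `w`, and some entry larger than `y` stands between them. -/
def Straddled (w : List ℕ) (y z : ℕ) : Prop := ∃ c, y < c ∧ [y, c, z].Sublist w

theorem Straddled.left_mem {w : List ℕ} {y z : ℕ} (h : Straddled w y z) : y ∈ w := by
  obtain ⟨c, -, hs⟩ := h
  exact hs.subset (by simp)

theorem Straddled.right_mem {w : List ℕ} {y z : ℕ} (h : Straddled w y z) : z ∈ w := by
  obtain ⟨c, -, hs⟩ := h
  exact hs.subset (by simp)

theorem not_straddled_nil {y z : ℕ} : ¬ Straddled [] y z := fun h => by simpa using h.left_mem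

theorem straddled_append_cons {M y z : ℕ} {L R : List ℕ} (hL : ∀ x ∈ L, x < M)
    (hR : ∀ x ∈ R, x < M) (hzy : z < y) :
    Straddled (L ++ M :: R) y z ↔ Straddled L y z ∨ Straddled R y z ∨ (y ∈ L ∧ z ∈ R) := by
  constructor
  · rintro ⟨c, hc, hs⟩
    rcases triple_sublist_append.1 hs with h | h | h | h
    · exact Or.inl ⟨c, hc, h⟩
    · have hy : y ∈ L := h.1.subset (by simp)
      rcases List.mem_cons.1 h.2 with rfl | h2
      · have := hL y hy; omega
      · exact Or.inr (Or.inr ⟨hy, h2⟩)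
    · have hz : z ∈ R := by
        rcases List.sublist_cons_iff.1 h.2 with h2 | ⟨r, h2, h3⟩
        · exact h2.subset (by simp)
        · simp only [List.cons.injEq] at h2
          obtain ⟨-, rfl⟩ := h2
          simpa using h3
      exact Or.inr (Or.inr ⟨h.1, hz⟩)
    · rcases List.sublist_cons_iff.1 h with h2 | ⟨r, h2, h3⟩
      · exact Or.inr (Or.inl ⟨c, hc, h2⟩)
      · simp only [List.cons.injEq] at h2
        obtain ⟨rfl, rfl⟩ := h2
        have := hR c (h3.subset (by simp))
        omega
  · rintro (⟨c, hc, hs⟩ | ⟨c, hc, hs⟩ | ⟨hy, hz⟩)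
    · exact ⟨c, hc, hs.trans (List.sublist_append_left _ _)⟩
    · exact ⟨c, hc, hs.trans ((List.sublist_cons_self M R).trans (List.sublist_append_right _ _))⟩
    · refine ⟨M, hL y hy, triple_sublist_append.2 (Or.inr (Or.inr (Or.inl ⟨hy, ?_⟩)))⟩
      exact List.Sublist.cons_cons M (by simpa using hz)

/-- The entry y leaves the stack before a later z < y enters only if a larger entry between them
forces it out. The proof splits at the maximum: a pair y ∈ L, z ∈ R is straddled by that maximum. -/
theorem pair_sublist_stackSort {y z : ℕ} (hzy : z < y) (w : List ℕ) (hn : w.Nodup) :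
    [y, z].Sublist (stackSort w) ↔ Straddled w y z := by
  refine max_induction (p := fun w => [y, z].Sublist (stackSort w) ↔ Straddled w y z)
    (by simp [not_straddled_nil]) (fun L M R hL hR _ _ ihL ihR => ?_) w hn
  · rw [stackSort_append_cons hL hR, straddled_append_cons hL hR hzy, pair_sublist_append,
      pair_sublist_append, ihL, ihR]
    simp only [List.mem_append, mem_stackSort, List.mem_singleton, List.sublist_singleton]
    constructor
    · rintro ((h | h | h) | ⟨h | h, rfl⟩ | h)
      · tauto
      · tauto
      · tauto
      · have := hL y h; omega
      · have := hR y h; omega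
      · simp at h
    · tauto

theorem pairwise_lt_iff_not_sublist {w : List ℕ} (hn : w.Nodup) :
    w.Pairwise (· < ·) ↔ ∀ y z, z < y → ¬ [y, z].Sublist w := by
  rw [List.pairwise_iff_forall_sublist]
  constructor
  · intro h y z hzy hs
    have := h hs
    omega
  · intro h y z hs
    by_contra hlt
    rcases (not_lt.1 hlt).lt_or_eq with h1 | h1
    · exact h y z h1 hs
    · subst h1
      simpa using hn.sublist hs

/-- The image of `w` under `s` avoids the pattern 231. -/
def TwiceSortable (w : List ℕ) : Prop := ∀ y z, z < y → ¬ Straddled (stackSort w) y z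

theorem pairwise_stackSort_stackSort {w : List ℕ} (hn : w.Nodup) :
    (stackSort (stackSort w)).Pairwise (· < ·) ↔ TwiceSortable w := by
  rw [pairwise_lt_iff_not_sublist (nodup_stackSort.2 (nodup_stackSort.2 hn))]
  exact forall₃_congr fun y z h => by rw [pair_sublist_stackSort h _ (nodup_stackSort.2 hn)]

/-! ### Legal spaces, and twice sortable words split at the largest entry -/

theorem isLegalSpace_iff {w : List ℕ} {a : ℕ} :
    IsLegalSpace w a ↔ ∀ y z, z ≤ a → a < y → ¬ Straddled w y z := by
  unfold IsLegalSpace Straddled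
  constructor
  · rintro h y z hz hy ⟨c, hc, hs⟩
    obtain ⟨f, hf⟩ := List.sublist_iff_exists_fin_orderEmbedding_get_eq.1 hs
    have h0 := hf ⟨0, by simp⟩
    have h1 := hf ⟨1, by simp⟩
    have h2 := hf ⟨2, by simp⟩
    simp only [List.get_eq_getElem, List.getElem_cons_zero, List.getElem_cons_succ] at h0 h1 h2
    exact h ⟨f ⟨0, by simp⟩, f ⟨1, by simp⟩, f ⟨2, by simp⟩, f.strictMono (by simp),
      f.strictMono (by simp), by simp only [List.get_eq_getElem]; omega,
        by simp only [List.get_eq_getElem]; omega, by simp only [List.get_eq_getElem]; omega⟩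
  · rintro h ⟨i, j, k, hij, hjk, hk, hi, hij'⟩
    refine h (w.get i) (w.get k) hk hi ⟨w.get j, hij', ?_⟩
    rw [List.sublist_iff_exists_fin_orderEmbedding_get_eq]
    refine ⟨OrderEmbedding.ofStrictMono (![i, j, k] : Fin 3 → _) ?_, ?_⟩
    · rw [Fin.strictMono_iff_lt_succ]
      intro t
      fin_cases t <;> simpa
    · intro t
      fin_cases t <;> rfl

theorem isLegalSpace_of_le {w : List ℕ} {a : ℕ} (h : ∀ x ∈ w, x ≤ a) : IsLegalSpace w a :=
  isLegalSpace_iff.2 fun y _ _ hy hs => by have := h y hs.left_mem; omega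

theorem isLegalSpace_of_lt {w : List ℕ} {a : ℕ} (h : ∀ x ∈ w, a < x) : IsLegalSpace w a :=
  isLegalSpace_iff.2 fun _ z hz _ hs => by have := h z hs.right_mem; omega

theorem isLegalSpace_append_cons {M a : ℕ} {A B : List ℕ} (hA : ∀ x ∈ A, x < M)
    (hB : ∀ x ∈ B, x < M) :
    IsLegalSpace (A ++ M :: B) a ↔
      IsLegalSpace A a ∧ IsLegalSpace B a ∧ ∀ y ∈ A, ∀ z ∈ B, z ≤ a → y ≤ a := by
  simp only [isLegalSpace_iff]
  constructor
  · intro h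
    refine ⟨fun y z hz hy hs => ?_, fun y z hz hy hs => ?_, fun y hy z hz hza => ?_⟩
    · exact h y z hz hy ((straddled_append_cons hA hB (by omega)).2 (Or.inl hs))
    · exact h y z hz hy ((straddled_append_cons hA hB (by omega)).2 (Or.inr (Or.inl hs)))
    · by_contra hya
      exact h y z hza (by omega)
        ((straddled_append_cons hA hB (by omega)).2 (Or.inr (Or.inr ⟨hy, hz⟩)))
  · rintro ⟨h1, h2, h3⟩ y z hz hy hs
    rcases (straddled_append_cons hA hB (by omega)).1 hs with h | h | h
    · exact h1 y z hz hy h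
    · exact h2 y z hz hy h
    · have := h3 y h.1 z h.2 hz
      omega

/-- A 231 in s(A)s(B)M lies within s(A), within s(B), or across the border with two entries in s(A)
or with one. In the last case the other two form an inversion of s(B), hence a straddled pair of B,
and the entry y of A is an illegal space of B. -/
theorem twiceSortable_append_cons {M : ℕ} {A B : List ℕ} (hA : ∀ x ∈ A, x < M)
    (hB : ∀ x ∈ B, x < M) (hBn : B.Nodup) (hdisj : ∀ x ∈ A, x ∉ B) :
    TwiceSortable (A ++ M :: B) ↔ TwiceSortable A ∧ TwiceSortable B ∧
      (∀ y c, y < c → [y, c].Sublist (stackSort A) → ∀ z ∈ B, y ≤ z) ∧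
      ∀ y ∈ A, IsLegalSpace B y := by
  -- The final M takes no part: nothing follows it, and it is too large to be the last letter of a
  -- 231.
  have key : ∀ y z, z < y → (Straddled (stackSort (A ++ M :: B)) y z ↔
      ∃ c, y < c ∧ [y, c, z].Sublist (stackSort A ++ stackSort B)) := by
    intro y z hzy
    rw [stackSort_append_cons hA hB, straddled_append_cons _ (by simp) hzy]
    · simp [Straddled]
    · simp only [List.mem_append, mem_stackSort]
      rintro x (h | h)
      exacts [hA x h, hB x h]
  constructor
  · intro h
    have h' : ∀ y c z, z < y → y < c → ¬ [y, c, z].Sublist (stackSort A ++ stackSort B) :=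
      fun y c z hzy hyc hs => h y z hzy ((key y z hzy).2 ⟨c, hyc, hs⟩)
    simp only [triple_sublist_append] at h'
    refine ⟨?_, ?_, ?_, ?_⟩
    · rintro y z hzy ⟨c, hyc, hs⟩
      exact h' y c z hzy hyc (Or.inl hs)
    · rintro y z hzy ⟨c, hyc, hs⟩
      exact h' y c z hzy hyc (Or.inr (Or.inr (Or.inr hs)))
    · intro y c hyc hs z hz
      by_contra hzy
      exact h' y c z (by omega) hyc (Or.inr (Or.inl ⟨hs, mem_stackSort.2 hz⟩))
    · intro y hy
      rw [isLegalSpace_iff]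
      intro c z hz hyc hs
      have hne : z ≠ y := by
        rintro rfl
        exact hdisj z hy hs.right_mem
      refine h' y c z (by omega) hyc (Or.inr (Or.inr (Or.inl ⟨mem_stackSort.2 hy, ?_⟩)))
      exact (pair_sublist_stackSort (by omega) B hBn).2 hs
  · rintro ⟨h1, h2, h3, h4⟩ y z hzy hs
    obtain ⟨c, hyc, hs⟩ := (key y z hzy).1 hs
    rcases triple_sublist_append.1 hs with h | h | h | h
    · exact h1 y z hzy ⟨c, hyc, h⟩
    · have := h3 y c hyc h.1 z (mem_stackSort.1 h.2)
      omega
    · exact isLegalSpace_iff.1 (h4 y (mem_stackSort.1 h.1)) c z hzy.le hyc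
        ((pair_sublist_stackSort (by omega) B hBn).1 h.2)
    · exact h2 y z hzy ⟨c, hyc, h⟩

theorem straddled_map {f : ℕ → ℕ} (hf : StrictMono f) {w : List ℕ} {y' z' : ℕ} :
    Straddled (w.map f) y' z' ↔ ∃ y z, f y = y' ∧ f z = z' ∧ Straddled w y z := by
  constructor
  · rintro ⟨c', hc, hs⟩
    obtain ⟨l, hl, he⟩ := List.sublist_map_iff.1 hs
    rcases l with _ | ⟨y, _ | ⟨c, _ | ⟨z, _ | _⟩⟩⟩ <;> simp at he
    obtain ⟨rfl, rfl, rfl⟩ := he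
    exact ⟨y, z, rfl, rfl, c, hf.lt_iff_lt.1 hc, hl⟩
  · rintro ⟨y, z, rfl, rfl, c, hc, hs⟩
    exact ⟨f c, hf hc, hs.map f⟩

theorem twiceSortable_map {f : ℕ → ℕ} (hf : StrictMono f) {w : List ℕ} :
    TwiceSortable (w.map f) ↔ TwiceSortable w := by
  unfold TwiceSortable
  rw [stackSort_map hf]
  constructor
  · intro h y z hzy hs
    exact h (f y) (f z) (hf hzy) ((straddled_map hf).2 ⟨y, z, rfl, rfl, hs⟩)
  · intro h y' z' hzy hs
    obtain ⟨y, z, rfl, rfl, hyz⟩ := (straddled_map hf).1 hs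
    exact h y z (hf.lt_iff_lt.1 hzy) hyz

theorem isLegalSpace_map {f : ℕ → ℕ} (hf : StrictMono f) {w : List ℕ} {a b : ℕ}
    (hab : ∀ v ∈ w, f v ≤ b ↔ v ≤ a) : IsLegalSpace (w.map f) b ↔ IsLegalSpace w a := by
  simp only [isLegalSpace_iff]
  constructor
  · intro h y z hz hy hs
    refine h (f y) (f z) ((hab z hs.right_mem).2 hz) ?_ ((straddled_map hf).2 ⟨y, z, rfl, rfl, hs⟩)
    by_contra hlt
    have := (hab y hs.left_mem).1 (by omega)
    omega
  · intro h y' z' hz hy hs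
    obtain ⟨y, z, rfl, rfl, hyz⟩ := (straddled_map hf).1 hs
    refine h y z ((hab z hyz.right_mem).1 hz) ?_ hyz
    by_contra hlt
    have := (hab y hyz.left_mem).2 (by omega)
    omega

/-! ### Permutations of `{1, …, n}` -/

theorem mem_permsOf_iff {n : ℕ} {w : List ℕ} :
    w ∈ permsOf n ↔ w.Nodup ∧ w.length = n ∧ ∀ x ∈ w, 1 ≤ x ∧ x ≤ n := by
  rw [mem_permsOf]
  constructor
  · intro h
    refine ⟨h.nodup_iff.2 (List.nodup_range' ..), by simpa using h.length_eq, fun x hx => ?_⟩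
    have := h.mem_iff.1 hx
    rw [List.mem_range'_1] at this
    omega
  · rintro ⟨hn, hl, hx⟩
    refine (List.subperm_of_subset hn fun x h => ?_).perm_of_length_le (by simp [hl])
    have := hx x h
    rw [List.mem_range'_1]
    omega

theorem mem_of_mem_permsOf {n x : ℕ} {w : List ℕ} (h : w ∈ permsOf n) (h1 : 1 ≤ x) (h2 : x ≤ n) :
    x ∈ w := by
  rw [(mem_permsOf.1 h).mem_iff, List.mem_range'_1]
  omega

theorem mem_sortable_two {n : ℕ} {w : List ℕ} :
    w ∈ sortable 2 n ↔ w ∈ permsOf n ∧ TwiceSortable w := by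
  rw [sortable, Finset.mem_filter]
  refine and_congr_right fun h => ?_
  rw [← pairwise_stackSort_stackSort (mem_permsOf_iff.1 h).1]
  rfl

theorem leg_eq_sum {w : List ℕ} {n : ℕ} (h : w.length = n) :
    leg w = ∑ a ∈ Finset.range (n + 1), if IsLegalSpace w a then 1 else 0 := by
  rw [leg, Finset.card_filter, h]

/-- Relabelling that leaves `1, …, q` in place and adds `c` to all larger values. -/
def raise (q c v : ℕ) : ℕ := if v ≤ q then v else v + c

theorem raise_strictMono (q c : ℕ) : StrictMono (raise q c) := by
  intro u v h
  unfold raise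
  split_ifs <;> omega

/-- Relabelling that adds `q` to all values and skips the value `q + 1 + c`. -/
def skip (q c v : ℕ) : ℕ := if v ≤ c then v + q else v + q + 1

theorem skip_strictMono (q c : ℕ) : StrictMono (skip q c) := by
  intro u v h
  unfold skip
  split_ifs <;> omega

/-- The permutation of `{1, …, q + i + 2}` whose entries left and right of the maximum are ordered
like `α` and `β`, where `1, …, q` stand on the left and the largest entry on the left is larger than
exactly `c` of the entries on the right. -/
def merge (q i c : ℕ) (α β : List ℕ) : List ℕ :=
  α.map (raise q c) ++ (q + 1 + i + 1) :: β.map (skip q c)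

section merge

variable {q i c : ℕ} {α β : List ℕ}

theorem raise_mem (hα : α ∈ permsOf (q + 1)) {x : ℕ} (hx : x ∈ α.map (raise q c)) :
    1 ≤ x ∧ (x ≤ q ∨ x = q + 1 + c) := by
  obtain ⟨v, hv, rfl⟩ := List.mem_map.1 hx
  have := (mem_permsOf_iff.1 hα).2.2 v hv
  unfold raise
  split_ifs <;> omega

theorem skip_mem (hβ : β ∈ permsOf i) {x : ℕ} (hx : x ∈ β.map (skip q c)) :
    q + 1 ≤ x ∧ x ≠ q + 1 + c ∧ x ≤ q + 1 + i := by
  obtain ⟨v, hv, rfl⟩ := List.mem_map.1 hx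
  have := (mem_permsOf_iff.1 hβ).2.2 v hv
  unfold skip
  split_ifs <;> omega

theorem max_mem_map_raise (hα : α ∈ permsOf (q + 1)) : q + 1 + c ∈ α.map (raise q c) :=
  List.mem_map.2 ⟨q + 1, mem_of_mem_permsOf hα (by omega) le_rfl, by simp [raise]⟩

theorem merge_mem_permsOf (hα : α ∈ permsOf (q + 1)) (hβ : β ∈ permsOf i) (hc : c ≤ i) :
    merge q i c α β ∈ permsOf (q + 1 + i + 1) := by
  rw [mem_permsOf_iff]
  obtain ⟨hαn, hαl, -⟩ := mem_permsOf_iff.1 hα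
  obtain ⟨hβn, hβl, -⟩ := mem_permsOf_iff.1 hβ
  refine ⟨?_, ?_, ?_⟩
  · rw [merge, List.nodup_middle, List.nodup_cons, List.nodup_append]
    refine ⟨?_, hαn.map (raise_strictMono q c).injective, hβn.map (skip_strictMono q c).injective,
      ?_⟩
    · rw [List.mem_append]
      rintro (h | h)
      · have := raise_mem hα h; omega
      · have := skip_mem hβ h; omega
    · rintro x hx y hy rfl
      have := raise_mem hα hx
      have := skip_mem hβ hy
      omega
  · simp [merge, hαl, hβl]; omega
  · intro x hx
    rw [merge, List.mem_append, List.mem_cons] at hx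
    rcases hx with h | rfl | h
    · have := raise_mem hα h; omega
    · omega
    · have := skip_mem hβ h; omega

theorem map_raise_lt (hα : α ∈ permsOf (q + 1)) (hc : c ≤ i) :
    ∀ x ∈ α.map (raise q c), x < q + 1 + i + 1 := fun x hx => by
  have := raise_mem hα hx; omega

theorem map_skip_lt (hβ : β ∈ permsOf i) :
    ∀ x ∈ β.map (skip q c), x < q + 1 + i + 1 := fun x hx => by
  have := skip_mem hβ hx; omega

theorem isLegalSpace_map_skip {a : ℕ} (ha : c ≤ a) :
    IsLegalSpace (β.map (skip q c)) (q + 1 + a) ↔ IsLegalSpace β a := by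
  refine isLegalSpace_map (skip_strictMono q c) fun v _ => ?_
  unfold skip
  split_ifs <;> omega

/-- Entries up to q lie below the whole right part, so they cause no 231 across the border. Only the
largest left entry q + 1 + c imposes a condition, and it marks the space c of `β`. -/
theorem twiceSortable_merge (hα : α ∈ permsOf (q + 1)) (hβ : β ∈ permsOf i) (hc : c ≤ i) :
    TwiceSortable (merge q i c α β) ↔ TwiceSortable α ∧ TwiceSortable β ∧ IsLegalSpace β c := by
  rw [merge, twiceSortable_append_cons (map_raise_lt hα hc) (map_skip_lt hβ)
    ((mem_permsOf_iff.1 hβ).1.map (skip_strictMono q c).injective) (fun x hx hx' => by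
      have := raise_mem hα hx; have := skip_mem hβ hx'; omega),
    twiceSortable_map (raise_strictMono q c), twiceSortable_map (skip_strictMono q c)]
  refine and_congr_right fun _ => and_congr_right fun _ => ?_
  constructor
  · rintro ⟨-, h⟩
    exact (isLegalSpace_map_skip le_rfl).1 (h _ (max_mem_map_raise hα))
  · intro h
    refine ⟨fun y d hyd hs z hz => ?_, fun y hy => ?_⟩
    · have h1 := raise_mem hα (mem_stackSort.1 (hs.subset (by simp : y ∈ [y, d])))
      have h2 := raise_mem hα (mem_stackSort.1 (hs.subset (by simp : d ∈ [y, d])))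
      have := skip_mem hβ hz
      omega
    · rcases (raise_mem hα hy).2 with h1 | rfl
      · exact isLegalSpace_of_lt fun x hx => by have := skip_mem hβ hx; omega
      · exact (isLegalSpace_map_skip le_rfl).2 h

/-- The spaces come in three ranges: up to q they behave as in `α`; from q + 1 to q + c none is
legal; from q + 1 + c on they behave as in `β`. -/
theorem leg_merge (hα : α ∈ permsOf (q + 1)) (hβ : β ∈ permsOf i) (hc : c ≤ i) :
    leg (merge q i c α β) = leg α +
      (((Finset.range (i + 1)).filter (IsLegalSpace β)).filter (c ≤ ·)).card := by
  have key : ∀ a, IsLegalSpace (merge q i c α β) a ↔ _ := fun a =>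
    isLegalSpace_append_cons (map_raise_lt hα hc) (map_skip_lt hβ)
  have low : ∀ a, a ≤ q → (IsLegalSpace (merge q i c α β) a ↔ IsLegalSpace α a) := by
    intro a ha
    rw [key, isLegalSpace_map (a := a) (raise_strictMono q c)]
    · refine and_iff_left ⟨isLegalSpace_of_lt fun x hx => ?_, fun y _ z hz hza => ?_⟩
      · have := skip_mem hβ hx; omega
      · have := skip_mem hβ hz; omega
    · intro v _
      unfold raise
      split_ifs <;> omega
  -- The largest left entry, the overall maximum and the smallest right entry q + 1 form the
  -- forbidden pattern.
  have mid : ∀ a, a < c → ¬ IsLegalSpace (merge q i c α β) (q + 1 + a) := by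
    intro a ha h
    have h1 := ((key _).1 h).2.2 _ (max_mem_map_raise hα) (skip q c 1)
      (List.mem_map_of_mem (mem_of_mem_permsOf hβ le_rfl (by omega)))
      (by unfold skip; split_ifs <;> omega)
    omega
  have high : ∀ a, c ≤ a → (IsLegalSpace (merge q i c α β) (q + 1 + a) ↔ IsLegalSpace β a) := by
    intro a ha
    rw [key, isLegalSpace_map_skip ha]
    constructor
    · exact fun h => h.2.1
    · refine fun h => ⟨isLegalSpace_of_le fun x hx => ?_, h, fun y hy _ _ _ => ?_⟩
      · have := raise_mem hα hx; omega
      · have := raise_mem hα hy; omega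
  have top : IsLegalSpace (merge q i c α β) (q + 1 + (i + 1)) :=
    (high _ (by omega)).2 (isLegalSpace_of_le fun x hx => by
      have := (mem_permsOf_iff.1 hβ).2.2 x hx; omega)
  -- The top space of `α` is always legal and is not among the low ones; it balances the top space
  -- of the merged word.
  have hq1 : IsLegalSpace α (q + 1) := isLegalSpace_of_le fun x hx =>
    ((mem_permsOf_iff.1 hα).2.2 x hx).2
  rw [leg_eq_sum (mem_permsOf_iff.1 (merge_mem_permsOf hα hβ hc)).2.1,
    leg_eq_sum (mem_permsOf_iff.1 hα).2.1,
    show q + 1 + i + 1 + 1 = (q + 1) + (i + 1 + 1) by ring, Finset.sum_range_add,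
    Finset.sum_range_succ _ (q + 1), Finset.sum_range_succ _ (i + 1), if_pos top, if_pos hq1,
    Finset.filter_filter, Finset.card_filter]
  have e1 : ∀ a ∈ Finset.range (q + 1), (if IsLegalSpace (merge q i c α β) a then 1 else 0) =
      if IsLegalSpace α a then 1 else 0 := fun a ha => by
    simp only [low a (by have := Finset.mem_range.1 ha; omega)]
  have e2 : ∀ a ∈ Finset.range (i + 1),
      (if IsLegalSpace (merge q i c α β) (q + 1 + a) then 1 else 0) =
      if IsLegalSpace β a ∧ c ≤ a then 1 else 0 := fun a ha => by
    by_cases h : c ≤ a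
    · simp [high a h, h]
    · simp [mid a (by omega), h]
  rw [Finset.sum_congr rfl e1, Finset.sum_congr rfl e2]
  ring

end merge

/-! ### Splitting twice sortable permutations at their largest entry -/

theorem twiceSortable_nil : TwiceSortable [] := fun _ _ _ h => by simpa using h.left_mem

theorem isLegalSpace_nil (a : ℕ) : IsLegalSpace [] a := isLegalSpace_of_le (by simp)

theorem lt_succ_of_mem_permsOf {n : ℕ} {w : List ℕ} (h : w ∈ permsOf n) : ∀ x ∈ w, x < n + 1 :=
  fun x hx => by have := (mem_permsOf_iff.1 h).2.2 x hx; omega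

theorem append_max_mem_permsOf {n : ℕ} {w : List ℕ} :
    w ++ [n + 1] ∈ permsOf (n + 1) ↔ w ∈ permsOf n := by
  rw [mem_permsOf, mem_permsOf, List.range'_concat]
  simp [Nat.add_comm, List.perm_append_right_iff]

theorem max_cons_mem_permsOf {n : ℕ} {w : List ℕ} :
    (n + 1) :: w ∈ permsOf (n + 1) ↔ w ∈ permsOf n := by
  rw [← append_max_mem_permsOf (w := w), mem_permsOf, mem_permsOf]
  exact (List.perm_append_singleton (n + 1) w).symm.congr_left _

theorem twiceSortable_append_max {M : ℕ} {w : List ℕ} (h : ∀ x ∈ w, x < M) :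
    TwiceSortable (w ++ [M]) ↔ TwiceSortable w := by
  rw [twiceSortable_append_cons h (by simp) (by simp) (by simp)]
  simp [twiceSortable_nil, isLegalSpace_nil]

theorem twiceSortable_max_cons {M : ℕ} {w : List ℕ} (h : ∀ x ∈ w, x < M) (hn : w.Nodup) :
    TwiceSortable (M :: w) ↔ TwiceSortable w := by
  have := twiceSortable_append_cons (A := []) (by simp) h hn (by simp)
  simpa [twiceSortable_nil] using this

theorem append_max_mem_sortable {n : ℕ} {w : List ℕ} :
    w ++ [n + 1] ∈ sortable 2 (n + 1) ↔ w ∈ sortable 2 n := by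
  rw [mem_sortable_two, mem_sortable_two, append_max_mem_permsOf]
  exact and_congr_right fun h => twiceSortable_append_max (lt_succ_of_mem_permsOf h)

theorem max_cons_mem_sortable {n : ℕ} {w : List ℕ} :
    (n + 1) :: w ∈ sortable 2 (n + 1) ↔ w ∈ sortable 2 n := by
  rw [mem_sortable_two, mem_sortable_two, max_cons_mem_permsOf]
  exact and_congr_right fun h =>
    twiceSortable_max_cons (lt_succ_of_mem_permsOf h) (mem_permsOf_iff.1 h).1

theorem isLegalSpace_append_max {M a : ℕ} {w : List ℕ} (h : ∀ x ∈ w, x < M) :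
    IsLegalSpace (w ++ [M]) a ↔ IsLegalSpace w a := by
  rw [isLegalSpace_append_cons h (by simp)]
  simp [isLegalSpace_nil]

theorem isLegalSpace_max_cons {M a : ℕ} {w : List ℕ} (h : ∀ x ∈ w, x < M) :
    IsLegalSpace (M :: w) a ↔ IsLegalSpace w a := by
  have := isLegalSpace_append_cons (A := []) (a := a) (by simp) h
  simpa [isLegalSpace_nil] using this

theorem leg_append_max {n : ℕ} {w : List ℕ} (h : w ∈ permsOf n) :
    leg (w ++ [n + 1]) = leg w + 1 := by
  have hl := (mem_permsOf_iff.1 h).2.1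
  rw [leg_eq_sum (n := n + 1) (by simp [hl]), leg_eq_sum hl, Finset.sum_range_succ]
  simp only [isLegalSpace_append_max (lt_succ_of_mem_permsOf h)]
  rw [if_pos (isLegalSpace_of_le fun x hx => (lt_succ_of_mem_permsOf h x hx).le)]

theorem leg_max_cons {n : ℕ} {w : List ℕ} (h : w ∈ permsOf n) :
    leg ((n + 1) :: w) = leg w + 1 := by
  have hl := (mem_permsOf_iff.1 h).2.1
  rw [leg_eq_sum (n := n + 1) (by simp [hl]), leg_eq_sum hl, Finset.sum_range_succ]
  simp only [isLegalSpace_max_cons (lt_succ_of_mem_permsOf h)]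
  rw [if_pos (isLegalSpace_of_le fun x hx => (lt_succ_of_mem_permsOf h x hx).le)]

theorem merge_mem_sortable {q i c : ℕ} {α β : List ℕ} (hα : α ∈ sortable 2 (q + 1))
    (hβ : β ∈ sortable 2 i) (hc : c ≤ i) (hleg : IsLegalSpace β c) :
    merge q i c α β ∈ sortable 2 (q + 1 + i + 1) := by
  rw [mem_sortable_two] at *
  exact ⟨merge_mem_permsOf hα.1 hβ.1 hc, (twiceSortable_merge hα.1 hβ.1 hc).2 ⟨hα.2, hβ.2, hleg⟩⟩

theorem exists_eq_append_max_of_mem_permsOf {n : ℕ} {w : List ℕ} (hw : w ∈ permsOf (n + 1)) :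
    ∃ A B, w = A ++ (n + 1) :: B ∧ A.Nodup ∧ B.Nodup ∧ (∀ x ∈ A, x ∉ B) ∧
      (∀ x ∈ A, 1 ≤ x ∧ x ≤ n) ∧ (∀ x ∈ B, 1 ≤ x ∧ x ≤ n) ∧ A.length + B.length = n := by
  obtain ⟨A, B, rfl⟩ := List.append_of_mem (mem_of_mem_permsOf hw (by omega) le_rfl)
  obtain ⟨hn, hl, hx⟩ := mem_permsOf_iff.1 hw
  rw [List.nodup_middle, List.nodup_cons, List.nodup_append] at hn
  obtain ⟨hm, hA, hB, hAB⟩ := hn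
  rw [List.mem_append, not_or] at hm
  refine ⟨A, B, rfl, hA, hB, fun x hxA hxB => hAB x hxA x hxB rfl, fun x hxA => ?_,
    fun x hxB => ?_, ?_⟩
  · have := hx x (by simp [hxA])
    have : x ≠ n + 1 := by rintro rfl; exact hm.1 hxA
    omega
  · have := hx x (by simp [hxB])
    have : x ≠ n + 1 := by rintro rfl; exact hm.2 hxB
    omega
  · simp at hl; omega

/-- The left part without its maximum m lies below the right part, hence is {1, …, q}. So m = q + 1
+ c for some c, and the two relabellings can be undone. -/
theorem exists_eq_merge {n : ℕ} {A B : List ℕ} (hw : A ++ (n + 1) :: B ∈ sortable 2 (n + 1))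
    (hA : A ≠ []) (hAn : A.Nodup) (hBn : B.Nodup) (hdisj : ∀ x ∈ A, x ∉ B)
    (hAx : ∀ x ∈ A, 1 ≤ x ∧ x ≤ n) (hBx : ∀ x ∈ B, 1 ≤ x ∧ x ≤ n)
    (hl : A.length + B.length = n) :
    ∃ q i c α β, q + 1 + i = n ∧ i = B.length ∧ c ≤ i ∧ IsLegalSpace β c ∧
      α ∈ sortable 2 (q + 1) ∧ β ∈ sortable 2 i ∧
      A ++ (n + 1) :: B = merge q i c α β := by
  obtain ⟨hp, ht⟩ := mem_sortable_two.1 hw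
  have hA1 : ∀ x ∈ A, x < n + 1 := fun x hx => by have := hAx x hx; omega
  have hB1 : ∀ x ∈ B, x < n + 1 := fun x hx => by have := hBx x hx; omega
  obtain ⟨-, -, hsep, -⟩ := (twiceSortable_append_cons hA1 hB1 hBn hdisj).1 ht
  obtain ⟨L, m, R, rfl, hL, hR⟩ := exists_eq_append_max hA hAn
  set A' := L ++ R with hA'
  have hA'n : A'.Nodup := by
    rw [List.nodup_middle, List.nodup_cons] at hAn
    exact hAn.2
  have hmemA : ∀ x, x ∈ L ++ m :: R ↔ x ∈ A' ∨ x = m := by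
    intro x; simp [hA']; tauto
  have hltm : ∀ y ∈ A', y < m := by
    intro y hy
    rcases List.mem_append.1 hy with h | h
    exacts [hL y h, hR y h]
  have hlt : ∀ y ∈ A', ∀ z ∈ B, y < z := by
    intro y hy z hz
    -- s(A) ends in m, so y and m stand in this order in s(A), and a z < y in B would complete a
    -- 231.
    have hle : y ≤ z := by
      refine hsep y m (hltm y hy) ?_ z hz
      rw [stackSort_append_cons hL hR]
      refine pair_sublist_append.2 (Or.inr (Or.inl ⟨?_, by simp⟩))
      simpa [mem_stackSort, hA'] using hy
    exact lt_of_le_of_ne hle (by rintro rfl; exact hdisj y ((hmemA y).2 (Or.inl hy)) hz)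
  have hlen : (L ++ m :: R).length = A'.length + 1 := by simp [hA']; omega
  set q := A'.length with hq
  have hcard : A'.toFinset.card = q := List.toFinset_card_of_nodup hA'n
  -- Each of the values 1, …, y occurs in the word and can stand only in A', so y is at most the
  -- size of A'.
  have hle : ∀ y ∈ A', y ≤ q := by
    intro y hy
    rw [← hcard]
    calc y = (Finset.Icc 1 y).card := by simp
      _ ≤ _ := Finset.card_le_card fun x hx => by
        rw [Finset.mem_Icc] at hx
        have hyn := hAx y ((hmemA y).2 (Or.inl hy))
        have hxw := mem_of_mem_permsOf hp hx.1 (by omega : x ≤ n + 1)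
        rw [List.mem_append, List.mem_cons, hmemA] at hxw
        rcases hxw with (h | rfl) | rfl | h
        · simpa using h
        · have := hltm y hy; omega
        · omega
        · have := hlt y hy x h; omega
  have hA'eq : A'.toFinset = Finset.Icc 1 q := by
    refine Finset.eq_of_subset_of_card_le (fun x hx => ?_) (by simp [hcard])
    rw [List.mem_toFinset] at hx
    rw [Finset.mem_Icc]
    exact ⟨(hAx x ((hmemA x).2 (Or.inl hx))).1, hle x hx⟩
  have hmem : ∀ x, 1 ≤ x → x ≤ q → x ∈ A' := fun x h1 h2 => by
    rw [← List.mem_toFinset, hA'eq, Finset.mem_Icc]; exact ⟨h1, h2⟩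
  have hmA : m ∈ L ++ m :: R := by simp
  have hqm : q < m := by
    by_contra h
    exact (hltm m (hmem m (hAx m hmA).1 (by omega))).ne rfl
  have hqB : ∀ z ∈ B, q < z := by
    intro z hz
    by_contra h
    exact (hlt z (hmem z (hBx z hz).1 (by omega)) z hz).ne rfl
  have hmn := (hAx m hmA).2
  have hmB : m ∉ B := hdisj m hmA
  obtain ⟨c, rfl⟩ : ∃ c, m = q + 1 + c := ⟨m - (q + 1), by omega⟩
  obtain ⟨α, hα⟩ : L ++ (q + 1 + c) :: R ∈ Set.range (List.map (raise q c)) := by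
    rw [Set.range_list_map]
    intro x hx
    rcases (hmemA x).1 hx with h | rfl
    · exact ⟨x, by simp [raise, hle x h]⟩
    · exact ⟨q + 1, by simp [raise]⟩
  obtain ⟨β, hβ⟩ : B ∈ Set.range (List.map (skip q c)) := by
    rw [Set.range_list_map]
    intro x hx
    have := hqB x hx
    have : x ≠ q + 1 + c := by rintro rfl; exact hmB hx
    by_cases h : x < q + 1 + c
    · refine ⟨x - q, ?_⟩
      unfold skip
      split_ifs <;> omega
    · refine ⟨x - q - 1, ?_⟩
      unfold skip
      split_ifs <;> omega
  have hci : c ≤ B.length := by omega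
  have hαp : α ∈ permsOf (q + 1) := by
    rw [mem_permsOf_iff]
    refine ⟨List.Nodup.of_map (raise q c) (hα ▸ hAn), ?_, fun v hv => ?_⟩
    · rw [← hlen, ← hα, List.length_map]
    · have hv' : raise q c v ∈ L ++ (q + 1 + c) :: R := hα ▸ List.mem_map_of_mem hv
      have h1 := (hAx _ hv').1
      have h2 : raise q c v ≤ q ∨ raise q c v = q + 1 + c := ((hmemA _).1 hv').imp_left (hle _)
      unfold raise at h1 h2
      split_ifs at h1 h2 <;> omega
  have hβp : β ∈ permsOf B.length := by
    rw [mem_permsOf_iff]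
    refine ⟨List.Nodup.of_map (skip q c) (hβ ▸ hBn), by rw [← hβ, List.length_map],
      fun v hv => ?_⟩
    have hv' : skip q c v ∈ B := hβ ▸ List.mem_map_of_mem hv
    have h1 := hqB _ hv'
    have h2 := (hBx _ hv').2
    unfold skip at h1 h2
    split_ifs at h1 h2 <;> omega
  have hn : q + 1 + B.length = n := by omega
  have hmerge : L ++ (q + 1 + c) :: R ++ (n + 1) :: B = merge q B.length c α β := by
    rw [merge, hα, hβ, hn]
  rw [hmerge] at ht
  have ht' := (twiceSortable_merge hαp hβp hci).1 ht
  exact ⟨q, B.length, c, α, β, hn, rfl, hci, ht'.2.2, mem_sortable_two.2 ⟨hαp, ht'.1⟩,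
    mem_sortable_two.2 ⟨hβp, ht'.2.1⟩, hmerge⟩

theorem append_cons_inj {M : ℕ} : ∀ {A A' B B' : List ℕ}, M ∉ A → M ∉ A' →
    A ++ M :: B = A' ++ M :: B' → A = A' ∧ B = B'
  | [], [], _, _, _, _, h => by simpa using h
  | [], a :: A', _, _, _, h2, h => by simp at h h2; omega
  | a :: A, [], _, _, h1, _, h => by simp at h h1; omega
  | a :: A, a' :: A', _, _, h1, h2, h => by
      simp only [List.cons_append, List.cons.injEq, List.mem_cons, not_or] at h h1 h2
      have := append_cons_inj h1.2 h2.2 h.2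
      simp [h.1, this]

theorem merge_injective {q i c q' i' c' : ℕ} {α β α' β' : List ℕ} (hα : α ∈ permsOf (q + 1))
    (hα' : α' ∈ permsOf (q' + 1)) (hc : c ≤ i) (hc' : c' ≤ i')
    (hn : q + 1 + i = q' + 1 + i') (h : merge q i c α β = merge q' i' c' α' β') :
    q = q' ∧ i = i' ∧ c = c' ∧ α = α' ∧ β = β' := by
  rw [merge, merge, ← hn] at h
  obtain ⟨h1, h2⟩ := append_cons_inj (fun hm => (map_raise_lt hα hc _ hm).ne rfl)
    (fun hm => (map_raise_lt hα' hc' _ hm).ne (by omega)) h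
  have hl := congrArg List.length h1
  rw [List.length_map, List.length_map, (mem_permsOf_iff.1 hα).2.1, (mem_permsOf_iff.1 hα').2.1]
    at hl
  obtain rfl : q = q' := by omega
  obtain rfl : i = i' := by omega
  obtain rfl : c = c' := by
    have := raise_mem hα' (h1 ▸ max_mem_map_raise hα)
    omega
  exact ⟨rfl, rfl, rfl, List.map_injective_iff.2 (raise_strictMono q c).injective h1,
    List.map_injective_iff.2 (skip_strictMono q c).injective h2⟩

/-- The legal spaces of a word of length `i`. -/
def legalSpaces (i : ℕ) (β : List ℕ) : Finset ℕ := (Finset.range (i + 1)).filter (IsLegalSpace β)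

theorem mem_legalSpaces {i c : ℕ} {β : List ℕ} :
    c ∈ legalSpaces i β ↔ c ≤ i ∧ IsLegalSpace β c := by
  simp [legalSpaces]

/-- The three sums put the maximum last, first and strictly inside. For n = 0 the first two cases
would coincide. -/
theorem sum_sortable_two_succ {R : Type*} [AddCommMonoid R] {n : ℕ} (hn : 1 ≤ n)
    (Φ : List ℕ → R) :
    ∑ w ∈ sortable 2 (n + 1), Φ w = ∑ w ∈ sortable 2 n, Φ (w ++ [n + 1]) +
      (∑ w ∈ sortable 2 n, Φ ((n + 1) :: w) +
      ∑ i ∈ Finset.Icc 1 (n - 1), ∑ α ∈ sortable 2 (n - i), ∑ β ∈ sortable 2 i,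
        ∑ c ∈ legalSpaces i β, Φ (merge (n - i - 1) i c α β)) := by
  classical
  have hperm : ∀ {k : ℕ} {w}, w ∈ sortable 2 k → w ∈ permsOf k := fun h => (mem_sortable_two.1 h).1
  have hnotMem : ∀ {w}, w ∈ sortable 2 n → n + 1 ∉ w := fun h hm =>
    (lt_succ_of_mem_permsOf (hperm h) _ hm).ne rfl
  have hne : ∀ {w}, w ∈ sortable 2 n → w ≠ [] := by
    rintro w h rfl
    have := (mem_permsOf_iff.1 (hperm h)).2.1
    simp at this
    omega
  simp only [Finset.sum_sigma']
  set K := ((Finset.Icc 1 (n - 1)).sigma fun i => (sortable 2 (n - i)).sigma fun _ =>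
    (sortable 2 i).sigma fun β => legalSpaces i β) with hK
  have hKmem : ∀ x ∈ K, ∃ q, n - x.1 - 1 = q ∧ n - x.1 = q + 1 ∧ q + 1 + x.1 = n ∧ 1 ≤ x.1 ∧
      x.2.1 ∈ sortable 2 (q + 1) ∧ x.2.2.1 ∈ sortable 2 x.1 ∧ x.2.2.2 ≤ x.1 ∧
      IsLegalSpace x.2.2.1 x.2.2.2 := by
    rintro ⟨i, α, β, c⟩ hx
    simp only [hK, Finset.mem_sigma, Finset.mem_Icc, mem_legalSpaces] at hx
    obtain ⟨hi, hα, hβ, hc⟩ := hx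
    have h1 : n - i = (n - i - 1) + 1 := by omega
    exact ⟨n - i - 1, rfl, h1, by dsimp only; omega, hi.1, h1 ▸ hα, hβ, hc⟩
  have himage : sortable 2 (n + 1) = (sortable 2 n).image (· ++ [n + 1]) ∪
      ((sortable 2 n).image ((n + 1) :: ·) ∪
        K.image fun x => merge (n - x.1 - 1) x.1 x.2.2.2 x.2.1 x.2.2.1) := by
    ext w
    simp only [Finset.mem_union, Finset.mem_image]
    constructor
    · intro hw
      obtain ⟨A, B, rfl, hA, hB, hAB, hAx, hBx, hl⟩ := exists_eq_append_max_of_mem_permsOf (hperm hw)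
      by_cases hB0 : B = []
      · subst hB0
        exact Or.inl ⟨A, append_max_mem_sortable.1 hw, rfl⟩
      by_cases hA0 : A = []
      · subst hA0
        exact Or.inr (Or.inl ⟨B, max_cons_mem_sortable.1 hw, rfl⟩)
      obtain ⟨q, i, c, α, β, hqi, hi, hc, hleg, hα, hβ, he⟩ :=
        exists_eq_merge hw hA0 hA hB hAB hAx hBx hl
      have hi1 : 1 ≤ i := hi ▸ List.length_pos_iff.2 hB0
      have h1 : n - i = q + 1 := by omega
      refine Or.inr (Or.inr ⟨⟨i, α, β, c⟩, ?_, ?_⟩)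
      · simp only [hK, Finset.mem_sigma, Finset.mem_Icc, mem_legalSpaces, h1]
        exact ⟨⟨hi1, by omega⟩, hα, hβ, hc, hleg⟩
      · rw [he]
        simp only [h1, Nat.add_sub_cancel]
    · rintro (⟨w, hw, rfl⟩ | ⟨w, hw, rfl⟩ | ⟨x, hx, rfl⟩)
      · exact append_max_mem_sortable.2 hw
      · exact max_cons_mem_sortable.2 hw
      · obtain ⟨q, hq, -, hqn, -, hα, hβ, hc, hleg⟩ := hKmem x hx
        have := merge_mem_sortable hα hβ hc hleg
        rwa [hqn, ← hq] at this
  have hKform : ∀ x ∈ K, ∃ A B, merge (n - x.1 - 1) x.1 x.2.2.2 x.2.1 x.2.2.1 = A ++ (n + 1) :: B ∧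
      A ≠ [] ∧ B ≠ [] ∧ n + 1 ∉ A := by
    intro x hx
    obtain ⟨q, hq, -, hqn, hx1, hα, hβ, hc, -⟩ := hKmem x hx
    refine ⟨x.2.1.map (raise q x.2.2.2), x.2.2.1.map (skip q x.2.2.2), by rw [merge, hq, hqn], ?_,
      ?_, fun hm => ?_⟩
    · rw [← List.length_pos_iff, List.length_map, (mem_permsOf_iff.1 (hperm hα)).2.1]
      omega
    · rw [← List.length_pos_iff, List.length_map, (mem_permsOf_iff.1 (hperm hβ)).2.1]
      omega
    · have := map_raise_lt (hperm hα) hc _ hm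
      omega
  rw [himage, Finset.sum_union, Finset.sum_union, Finset.sum_image, Finset.sum_image,
    Finset.sum_image]
  · intro x hx y hy hxy
    obtain ⟨q, hq, -, hqn, hx1, hα, hβ, hc, -⟩ := hKmem x hx
    obtain ⟨q', hq', -, hqn', hx1', hα', hβ', hc', -⟩ := hKmem y hy
    simp only [hq, hq'] at hxy
    have := merge_injective (hperm hα) (hperm hα') hc hc' (by omega) hxy
    obtain ⟨i, α, β, c⟩ := x
    obtain ⟨i', α', β', c'⟩ := y
    obtain ⟨-, h1, h2, h3, h4⟩ := this
    dsimp only at h1 h2 h3 h4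
    subst h1 h2 h3 h4
    rfl
  · intro x _ y _ hxy
    exact (List.cons.inj hxy).2
  · intro x _ y _ hxy
    exact List.append_cancel_right hxy
  · rw [Finset.disjoint_left]
    intro w hw hw'
    obtain ⟨u, hu, rfl⟩ := Finset.mem_image.1 hw
    obtain ⟨x, hx, he⟩ := Finset.mem_image.1 hw'
    obtain ⟨A, B, hAB, hA, -, hm⟩ := hKform x hx
    rw [hAB] at he
    have := append_cons_inj (A' := []) hm (by simp) he
    exact hA this.1
  · rw [Finset.disjoint_left]
    intro w hw hw'
    obtain ⟨u, hu, rfl⟩ := Finset.mem_image.1 hw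
    rcases Finset.mem_union.1 hw' with hw' | hw'
    · obtain ⟨v, hv, he⟩ := Finset.mem_image.1 hw'
      have := append_cons_inj (A := []) (by simp) (hnotMem hu) he
      exact hne hu this.1.symm
    · obtain ⟨x, hx, he⟩ := Finset.mem_image.1 hw'
      obtain ⟨A, B, hAB, -, hB, hm⟩ := hKform x hx
      rw [hAB] at he
      have := append_cons_inj hm (hnotMem hu) he
      exact hB this.2

/-! ### Sums over the factorizations of a word -/

section splitSum

variable {R : Type*} [AddCommMonoid R]

/-- The sum of `f u v` over all factorizations `w = uv`. -/
def splitSum : (List ℕ → List ℕ → R) → List ℕ → R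
  | f, [] => f [] []
  | f, a :: w => f [] (a :: w) + splitSum (fun u v => f (a :: u) v) w

/-- The sum of `f u v` over all factorizations `w = utv` with a single entry `t`. -/
def pointSum : (List ℕ → List ℕ → R) → List ℕ → R
  | _, [] => 0
  | f, a :: w => f [] w + pointSum (fun u v => f (a :: u) v) w

theorem splitSum_congr {f g : List ℕ → List ℕ → R} {w : List ℕ}
    (h : ∀ u v, u ++ v = w → f u v = g u v) : splitSum f w = splitSum g w := by
  induction w generalizing f g with
  | nil => exact h [] [] rfl
  | cons a w ih =>
      rw [splitSum, splitSum, h [] _ rfl, ih fun u v huv => h (a :: u) v (by simp [huv])]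

theorem pointSum_congr {f g : List ℕ → List ℕ → R} {w : List ℕ}
    (h : ∀ u t v, u ++ t :: v = w → f u v = g u v) : pointSum f w = pointSum g w := by
  induction w generalizing f g with
  | nil => rfl
  | cons a w ih =>
      rw [pointSum, pointSum, h [] a _ rfl, ih fun u t v huv => h (a :: u) t v (by simp [huv])]

theorem splitSum_add (f g : List ℕ → List ℕ → R) (w : List ℕ) :
    splitSum (fun u v => f u v + g u v) w = splitSum f w + splitSum g w := by
  induction w generalizing f g with
  | nil => rfl
  | cons a w ih => simp only [splitSum, ih]; abel

theorem pointSum_add (f g : List ℕ → List ℕ → R) (w : List ℕ) :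
    pointSum (fun u v => f u v + g u v) w = pointSum f w + pointSum g w := by
  induction w generalizing f g with
  | nil => simp [pointSum]
  | cons a w ih => simp only [pointSum, ih]; abel

theorem splitSum_append_cons (f : List ℕ → List ℕ → R) (A B : List ℕ) (m : ℕ) :
    splitSum f (A ++ m :: B) =
      splitSum (fun p q => f p (q ++ m :: B)) A + splitSum (fun p q => f (A ++ m :: p) q) B := by
  induction A generalizing f with
  | nil => simp [splitSum]
  | cons a A ih => simp [splitSum, ih, add_assoc]

theorem splitSum_append_of_eq_zero (f : List ℕ → List ℕ → R) (B T : List ℕ)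
    (h : ∀ p q, q ≠ [] → p ++ q = B → f p (q ++ T) = 0) :
    splitSum f (B ++ T) = splitSum (fun p q => f (B ++ p) q) T := by
  induction B generalizing f with
  | nil => rfl
  | cons b B ih =>
      have h0 := h [] (b :: B) (by simp) rfl
      simp only [List.cons_append] at h0
      rw [List.cons_append, splitSum, h0, ih, zero_add]
      · rfl
      · exact fun p q hq hpq => h (b :: p) q hq (by simp [hpq])

theorem pointSum_append_singleton (f : List ℕ → List ℕ → R) (T : List ℕ) (t : ℕ) :
    pointSum f (T ++ [t]) = pointSum (fun p q => f p (q ++ [t])) T + f T [] := by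
  induction T generalizing f with
  | nil => simp [pointSum]
  | cons a T ih => simp [pointSum, ih, add_assoc]

theorem splitSum_pointSum_comm (G : List ℕ → List ℕ → List ℕ → List ℕ → R) (A T : List ℕ) :
    splitSum (fun p q => pointSum (G p q) T) A =
      pointSum (fun a b => splitSum (fun p q => G p q a b) A) T := by
  induction A generalizing G with
  | nil => rfl
  | cons a A ih => simp only [splitSum, pointSum_add, ih]

/-- Both sides run over the factorizations T = a t b q with a single entry t. -/
theorem splitSum_pointSum_assoc (G : List ℕ → List ℕ → List ℕ → R) (T : List ℕ) :
    splitSum (fun p q => pointSum (fun a b => G a b q) p) T =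
      pointSum (fun a r => splitSum (fun b q => G a b q) r) T := by
  induction T generalizing G with
  | nil => rfl
  | cons t T ih => simp only [splitSum, pointSum, splitSum_add, ih, zero_add]

theorem splitSum_eq_sum (f : List ℕ → List ℕ → R) (w : List ℕ) :
    splitSum f w = ∑ k ∈ Finset.range (w.length + 1), f (w.take k) (w.drop k) := by
  induction w generalizing f with
  | nil => simp [splitSum]
  | cons a w ih =>
      rw [splitSum, ih, List.length_cons, Finset.sum_range_succ' _ (w.length + 1), add_comm]
      simp

theorem pointSum_range' (f : List ℕ → List ℕ → R) (s r : ℕ) :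
    pointSum f (List.range' s r) = ∑ j ∈ Finset.range r,
      f (List.range' s j) (List.range' (s + j + 1) (r - j - 1)) := by
  induction r generalizing s f with
  | zero => rfl
  | succ r ih =>
      rw [List.range'_succ, pointSum, ih, Finset.sum_range_succ', add_comm]
      congr 1
      refine Finset.sum_congr rfl fun j _ => ?_
      rw [List.range'_succ, show s + 1 + j + 1 = s + (j + 1) + 1 by ring,
        show r - j - 1 = r + 1 - (j + 1) - 1 by omega]

end splitSum

theorem mul_splitSum {R : Type*} [CommSemiring R] (a : R) (f : List ℕ → List ℕ → R) (w : List ℕ) :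
    a * splitSum f w = splitSum (fun u v => a * f u v) w := by
  simp only [splitSum_eq_sum, Finset.mul_sum]

theorem mul_pointSum {R : Type*} [CommSemiring R] (a : R) (f : List ℕ → List ℕ → R) (w : List ℕ) :
    a * pointSum f w = pointSum (fun u v => a * f u v) w := by
  induction w generalizing f with
  | nil => simp [pointSum]
  | cons b w ih => simp only [pointSum, mul_add, ih]

/-! ### Descents and peaks around the largest entry -/

theorem des_append_cons {M : ℕ} {L R : List ℕ} (hL : ∀ x ∈ L, x < M) (hR : ∀ x ∈ R, x < M) :
    des (L ++ M :: R) = des L + des R + if R = [] then 0 else 1 := by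
  induction L with
  | nil =>
      cases R with
      | nil => simp [des]
      | cons b R => simp [des, hR b (by simp), add_comm]
  | cons a L ih =>
      have ih := ih fun x hx => hL x (by simp [hx])
      have ha := hL a (by simp)
      cases L with
      | nil =>
          simp only [List.nil_append] at ih
          simp only [List.cons_append, List.nil_append, des, ih, if_neg ha.not_gt]
          omega
      | cons b L =>
          simp only [List.cons_append] at ih
          simp only [List.cons_append, des, ih]
          omega

theorem peak_append_cons {M : ℕ} {L R : List ℕ} (hL : ∀ x ∈ L, x < M) (hR : ∀ x ∈ R, x < M) :
    peak (L ++ M :: R) = peak L + peak R + if L = [] ∨ R = [] then 0 else 1 := by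
  have hM : peak (M :: R) = peak R := by
    rcases R with _ | ⟨b, _ | ⟨c, R⟩⟩
    · simp [peak]
    · simp [peak]
    · have := hR b (by simp)
      rw [peak, if_neg (by omega), zero_add]
  induction L with
  | nil => simp [hM, peak]
  | cons a L ih =>
      have ih := ih fun x hx => hL x (by simp [hx])
      have ha := hL a (by simp)
      rcases L with _ | ⟨b, _ | ⟨c, L⟩⟩
      · cases R with
        | nil => simp [peak]
        | cons b R => simp [peak, hM, ha, hR b (by simp), add_comm]
      · have hb := hL b (by simp)
        simp only [List.cons_append, List.nil_append] at ih
        simp only [List.cons_append, List.nil_append, peak, ih, hb.not_gt]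
        simp
      · simp only [List.cons_append] at ih
        simp only [List.cons_append, peak, ih]
        simp
        omega

theorem des_map {f : ℕ → ℕ} (hf : StrictMono f) (w : List ℕ) : des (w.map f) = des w := by
  induction w with
  | nil => rfl
  | cons a w ih =>
      cases w with
      | nil => rfl
      | cons b w =>
          simp only [List.map_cons] at ih
          simp only [List.map_cons, des, ih, hf.lt_iff_lt]

theorem peak_map {f : ℕ → ℕ} (hf : StrictMono f) (w : List ℕ) : peak (w.map f) = peak w := by
  induction w with
  | nil => rfl
  | cons a w ih =>
      rcases w with _ | ⟨b, _ | ⟨c, w⟩⟩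
      · rfl
      · rfl
      · simp only [List.map_cons] at ih
        simp only [List.map_cons, peak, ih, hf.lt_iff_lt]

/-! ### The weighted number of preimages of a word -/

noncomputable section

open MvPolynomial

/-- The preimages of `w` under `s`. -/
def preimages (w : List ℕ) : Finset (List ℕ) :=
  w.permutations.toFinset.filter fun σ => stackSort σ = w

theorem mem_preimages {w σ : List ℕ} : σ ∈ preimages w ↔ stackSort σ = w := by
  rw [preimages, Finset.mem_filter, List.mem_toFinset, List.mem_permutations]
  exact ⟨And.right, fun h => ⟨h ▸ (stackSort_perm σ).symm, h⟩⟩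

theorem preimages_nil : preimages [] = {[]} := by
  ext σ
  rw [mem_preimages, Finset.mem_singleton]
  refine ⟨fun h => ?_, fun h => by simp [h]⟩
  have := stackSort_perm σ
  rw [h] at this
  exact List.nil_perm.1 this

theorem ne_nil_of_mem_preimages {w σ : List ℕ} (h : σ ∈ preimages w) (hw : w ≠ []) : σ ≠ [] := by
  rintro rfl
  rw [mem_preimages, stackSort_nil] at h
  exact hw h.symm

/-- The sum of the weights of the preimages of `w` under `s`. -/
def fertility (w : List ℕ) : MvPolynomial (Fin 2) ℤ := ∑ σ ∈ preimages w, weight σ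

theorem fertility_map {f : ℕ → ℕ} (hf : StrictMono f) (w : List ℕ) :
    fertility (w.map f) = fertility w := by
  symm
  refine Finset.sum_bij (fun σ _ => σ.map f) ?_ ?_ ?_ ?_
  · intro σ h
    rw [mem_preimages] at h ⊢
    rw [stackSort_map hf, h]
  · exact fun _ _ _ _ h => List.map_injective_iff.2 hf.injective h
  · intro τ hτ
    rw [mem_preimages] at hτ
    obtain ⟨σ, rfl⟩ : τ ∈ Set.range (List.map f) := by
      rw [Set.range_list_map]
      intro x hx
      rw [← mem_stackSort, hτ] at hx
      obtain ⟨v, -, rfl⟩ := List.mem_map.1 hx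
      exact ⟨v, rfl⟩
    rw [stackSort_map hf] at hτ
    exact ⟨σ, mem_preimages.2 (List.map_injective_iff.2 hf.injective hτ), rfl⟩
  · intro σ _
    rw [weight, weight, des_map hf, peak_map hf]

/-- Fertility depends only on relative order, so an increasing run above `w` may start anywhere
above `w`. -/
theorem fertility_append_range'_shift {w : List ℕ} {s t : ℕ} (r : ℕ) (hw : ∀ x ∈ w, x < s)
    (hst : s ≤ t) : fertility (w ++ List.range' t r) = fertility (w ++ List.range' s r) := by
  have hf : StrictMono fun v => if v < s then v else v + (t - s) := by
    intro u v h
    dsimp only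
    split_ifs <;> omega
  rw [← fertility_map hf (w ++ List.range' s r), List.map_append]
  congr 2
  · symm
    rw [List.map_congr_left (g := id) fun x hx => by simp [hw x hx], List.map_id]
  · rw [List.map_congr_left (g := fun v => (t - s) + v), List.map_add_range']
    · congr 1; omega
    · intro v hv
      rw [List.mem_range'_1] at hv
      rw [if_neg (by omega), add_comm]

/-- The factor that a possibly empty first factor contributes next to a nonempty second one. -/
def leftFactor (u : List ℕ) : MvPolynomial (Fin 2) ℤ := if u = [] then X 0 else fertility u

/-- The factor that a possibly empty second factor contributes next to a nonempty first one. -/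
def rightFactor (v : List ℕ) : MvPolynomial (Fin 2) ℤ := if v = [] then 1 else fertility v

/-- The weighted number of preimages of `uvM`, for `M` larger than all entries of `u` and `v`, whose
entries left and right of `M` are sent to `u` and `v`. -/
def joined (u v : List ℕ) : MvPolynomial (Fin 2) ℤ :=
  if v = [] then (if u = [] then X 0 * X 1 else fertility u) else leftFactor u * fertility v

theorem joined_of_left_ne_nil {u v : List ℕ} (hu : u ≠ []) :
    joined u v = fertility u * rightFactor v := by
  unfold joined leftFactor rightFactor
  split_ifs <;> simp

theorem joined_of_right_ne_nil {u v : List ℕ} (hv : v ≠ []) :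
    joined u v = leftFactor u * fertility v := by
  rw [joined, if_neg hv]

/-- The exponents des + 1 and peak + 1 make the weight multiplicative when both sides of M are
nonempty, as M adds one descent and one peak. The empty word has weight xy, which is not the factor
it contributes beside M; hence the separate cases. -/
theorem sum_weight_append_cons {u v : List ℕ} {M : ℕ} (hu : ∀ x ∈ u, x < M)
    (hv : ∀ x ∈ v, x < M) :
    ∑ L ∈ preimages u, ∑ R ∈ preimages v, weight (L ++ M :: R) = joined u v := by
  have key : ∀ L ∈ preimages u, ∀ R ∈ preimages v, weight (L ++ M :: R) =
      X 0 ^ (des L + des R + (if R = [] then 0 else 1) + 1) *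
      X 1 ^ (peak L + peak R + (if L = [] ∨ R = [] then 0 else 1) + 1) := by
    intro L hL R hR
    rw [mem_preimages] at hL hR
    have h1 : ∀ x ∈ L, x < M := fun x hx => hu x (by rwa [← hL, mem_stackSort])
    have h2 : ∀ x ∈ R, x < M := fun x hx => hv x (by rwa [← hR, mem_stackSort])
    rw [weight, des_append_cons h1 h2, peak_append_cons h1 h2]
  rw [Finset.sum_congr rfl fun L hL => Finset.sum_congr rfl fun R hR => key L hL R hR]
  unfold joined leftFactor
  by_cases hu0 : u = [] <;> by_cases hv0 : v = []
  · simp [hu0, hv0, preimages_nil, des, peak]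
  · subst hu0
    rw [preimages_nil, Finset.sum_singleton, if_neg hv0, if_pos rfl, fertility, Finset.mul_sum]
    refine Finset.sum_congr rfl fun R hR => ?_
    rw [if_neg (ne_nil_of_mem_preimages hR hv0), weight]
    simp [des, peak]
    ring
  · subst hv0
    rw [preimages_nil, if_pos rfl, if_neg hu0, fertility]
    refine Finset.sum_congr rfl fun L hL => ?_
    rw [Finset.sum_singleton, weight]
    simp [des, peak]
  · simp only [if_neg hu0, if_neg hv0]
    rw [fertility, fertility, Finset.sum_mul_sum]
    refine Finset.sum_congr rfl fun L hL => Finset.sum_congr rfl fun R hR => ?_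
    have h1 := ne_nil_of_mem_preimages hL hu0
    have h2 := ne_nil_of_mem_preimages hR hv0
    simp only [h1, h2, or_self, if_false, weight]
    ring

theorem fertility_append_max {w : List ℕ} {M : ℕ} (hw : ∀ x ∈ w, x < M) :
    fertility (w ++ [M]) = splitSum joined w := by
  have hsplit : splitSum joined w = splitSum
      (fun u v => ∑ L ∈ preimages u, ∑ R ∈ preimages v, weight (L ++ M :: R)) w :=
    splitSum_congr fun u v huv => (sum_weight_append_cons
      (fun x hx => hw x (by simp [← huv, hx])) (fun x hx => hw x (by simp [← huv, hx]))).symm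
  rw [hsplit, splitSum_eq_sum]
  simp only [Finset.sum_sigma']
  symm
  have hmem : ∀ x ∈ (Finset.range (w.length + 1)).sigma fun k =>
      (preimages (w.take k)).sigma fun _ => preimages (w.drop k),
      x.2.1.length = x.1 ∧ stackSort x.2.1 ++ stackSort x.2.2 = w ∧
        (∀ y ∈ x.2.1, y < M) ∧ ∀ y ∈ x.2.2, y < M := by
    rintro ⟨k, L, R⟩ hx
    simp only [Finset.mem_sigma, mem_preimages, Finset.mem_range] at hx
    obtain ⟨hk, hL, hR⟩ := hx
    refine ⟨?_, by simp [hL, hR], fun y hy => hw y ?_, fun y hy => hw y ?_⟩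
    · have := congrArg List.length hL
      rw [(stackSort_perm L).length_eq, List.length_take] at this
      dsimp only
      omega
    · rw [← mem_stackSort, hL] at hy
      exact List.mem_of_mem_take hy
    · rw [← mem_stackSort, hR] at hy
      exact List.mem_of_mem_drop hy
  refine Finset.sum_bij (fun x _ => x.2.1 ++ M :: x.2.2) ?_ ?_ ?_ ?_
  · intro x hx
    obtain ⟨-, h1, h2, h3⟩ := hmem x hx
    rw [mem_preimages, stackSort_append_cons h2 h3, h1]
  · intro x hx y hy hxy
    obtain ⟨h0, -, h1, -⟩ := hmem x hx
    obtain ⟨h0', -, h1', -⟩ := hmem y hy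
    obtain ⟨e1, e2⟩ := append_cons_inj (fun h => (h1 _ h).ne rfl) (fun h => (h1' _ h).ne rfl) hxy
    obtain ⟨k, L, R⟩ := x
    obtain ⟨k', L', R'⟩ := y
    dsimp only at e1 e2 h0 h0'
    subst e1 e2 h0 h0'
    rfl
  · intro σ hσ
    rw [mem_preimages] at hσ
    have hp := stackSort_perm σ
    rw [hσ] at hp
    obtain ⟨L, R, rfl⟩ := List.append_of_mem (hp.mem_iff.1 (by simp : M ∈ w ++ [M]))
    have hp' : w.Perm (L ++ R) := by
      have := ((List.perm_append_singleton M w).symm.trans hp).trans List.perm_middle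
      exact (List.perm_cons M).1 this
    have hL : ∀ x ∈ L, x < M := fun x hx => hw x (hp'.mem_iff.2 (by simp [hx]))
    have hR : ∀ x ∈ R, x < M := fun x hx => hw x (hp'.mem_iff.2 (by simp [hx]))
    rw [stackSort_append_cons hL hR] at hσ
    have hw' := List.append_cancel_right hσ
    have hlen : (stackSort L).length = L.length := (stackSort_perm L).length_eq
    refine ⟨⟨L.length, L, R⟩, ?_, rfl⟩
    simp only [Finset.mem_sigma, mem_preimages, Finset.mem_range, ← hw', ← hlen]
    simp
  · intro x hx
    rfl

/-- Every nonempty image under s ends in its largest entry. -/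
theorem fertility_eq_zero {A B : List ℕ} {m : ℕ} (hn : (A ++ m :: B).Nodup)
    (hB : ∀ x ∈ B, x < m) (hB0 : B ≠ []) : fertility (A ++ m :: B) = 0 := by
  have : preimages (A ++ m :: B) = ∅ := by
    rw [Finset.eq_empty_iff_forall_notMem]
    intro σ hσ
    rw [mem_preimages] at hσ
    have hp := stackSort_perm σ
    rw [hσ] at hp
    have hσn : σ.Nodup := hp.nodup_iff.1 hn
    have hσ0 : σ ≠ [] := by rintro rfl; simp at hσ
    obtain ⟨L, M, R, rfl, hL, hR⟩ := exists_eq_append_max hσ0 hσn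
    rw [stackSort_append_cons hL hR] at hσ
    have hlast := congrArg List.getLast? hσ
    obtain ⟨B', b, rfl⟩ := List.eq_nil_or_concat' B |>.resolve_left hB0
    rw [show A ++ m :: (B' ++ [b]) = (A ++ m :: B') ++ [b] by simp] at hlast
    rw [List.getLast?_concat, List.getLast?_concat, Option.some_inj] at hlast
    have h1 := hB b (by simp)
    have h2 := hp.mem_iff.1 (by simp : m ∈ A ++ m :: (B' ++ [b]))
    rw [List.mem_append, List.mem_cons] at h2
    rcases h2 with h | h | h
    · have := hL m h; omega
    · omega
    · have := hR m h; omega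
  rw [fertility, this, Finset.sum_empty]

/-- Splitting off what stands between a descent top `m` and an entry of the increasing sequence
`T` of all later entries that exceed `m`. -/
theorem fertility_decomposition {m : ℕ} {B : List ℕ} (hB : ∀ x ∈ B, x < m) (hB0 : B ≠ [])
    (A T : List ℕ) (hA : ∀ x ∈ A, x < m) (hn : (A ++ m :: B).Nodup) (hT : T.Pairwise (· < ·))
    (hmT : ∀ x ∈ T, m < x) :
    fertility (A ++ m :: (B ++ T)) =
      pointSum (fun p q => fertility (B ++ p) * fertility (A ++ m :: q)) T := by
  induction hr : T.length using Nat.strong_induction_on generalizing A T with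
  | _ r ih =>
    subst hr
    rcases List.eq_nil_or_concat' T with rfl | ⟨T, t, rfl⟩
    · rw [List.append_nil, fertility_eq_zero hn hB hB0, pointSum]
    rw [List.pairwise_append] at hT
    obtain ⟨hT, -, hTt⟩ := hT
    have hTt' : ∀ x ∈ T, x < t := fun x hx => hTt x hx t (by simp)
    have hmt : m < t := hmT t (by simp)
    have hmT' : ∀ x ∈ T, m < x := fun x hx => hmT x (by simp [hx])
    have hlt : ∀ q, (∀ x ∈ q, x ∈ T) → ∀ x ∈ A ++ m :: q, x < t := by
      intro q hq x hx
      rw [List.mem_append, List.mem_cons] at hx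
      rcases hx with h | rfl | h
      · exact (hA x h).trans hmt
      · exact hmt
      · exact hTt' x (hq x h)
    rw [show A ++ m :: (B ++ (T ++ [t])) = (A ++ m :: (B ++ T)) ++ [t] by simp,
      fertility_append_max, splitSum_append_cons, pointSum_append_singleton]
    swap
    · intro x hx
      rw [List.mem_append, List.mem_cons, List.mem_append] at hx
      rcases hx with h | rfl | h | h
      · exact (hA x h).trans hmt
      · exact hmt
      · exact (hB x h).trans hmt
      · exact hTt' x h
    -- Cuts inside A leave the descent at m in the second factor; the induction hypothesis applies
    -- with a suffix of A and the shorter T.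
    have e1 : splitSum (fun p q => joined p (q ++ m :: (B ++ T))) A =
        pointSum (fun p1 r => fertility (B ++ p1) *
          splitSum (fun p q => joined p (q ++ m :: r)) A) T := by
      simp only [mul_splitSum]
      rw [← splitSum_pointSum_comm (fun p q a b => fertility (B ++ a) * joined p (q ++ m :: b))]
      refine splitSum_congr fun p q hpq => ?_
      have hqA : ∀ x ∈ q, x ∈ A := fun x hx => by simp [← hpq, hx]
      rw [joined_of_right_ne_nil (by simp), ih T.length (by simp) q T (fun x hx => hA x (hqA x hx))
        (hn.sublist ?_) hT hmT' rfl, mul_pointSum]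
      · refine pointSum_congr fun u _ v _ => ?_
        rw [joined_of_right_ne_nil (by simp)]
        ring
      · exact List.Sublist.append_right (hpq ▸ List.sublist_append_right p q) _
    -- The cut right after m gives the summand belonging to t. Cuts inside B give a first factor
    -- that does not end in its maximum, hence 0. Cuts at or after the end of B use the induction
    -- hypothesis with a prefix of T.
    have e2 : splitSum (fun p q => joined (A ++ m :: p) q) (B ++ T) =
        fertility (B ++ T) * fertility (A ++ [m]) +
        pointSum (fun p1 r => fertility (B ++ p1) *
          splitSum (fun p q => joined (A ++ m :: p) q) r) T := by
      obtain ⟨b, B', rfl⟩ := List.exists_cons_of_ne_nil hB0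
      rw [List.cons_append, splitSum, splitSum_append_of_eq_zero]
      · congr 1
        · rw [joined_of_right_ne_nil (by simp), leftFactor, if_neg (by simp)]
          ring
        · simp only [mul_splitSum]
          rw [← splitSum_pointSum_assoc
            (fun a b' q => fertility (b :: B' ++ a) * joined (A ++ m :: b') q)]
          refine splitSum_congr fun p q hpq => ?_
          have hpT : p.Sublist T := hpq ▸ List.sublist_append_left p q
          have := ih p.length (by have := hpT.length_le; simp; omega) A p hA hn (hT.sublist hpT)
            (fun x hx => hmT' x (hpT.subset hx)) rfl
          simp only [List.cons_append] at this
          rw [joined_of_left_ne_nil (by simp), this, mul_comm, mul_pointSum]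
          refine pointSum_congr fun u _ v _ => ?_
          rw [joined_of_left_ne_nil (by simp)]
          simp only [List.cons_append]
          ring
      · intro p q hq hpq
        rw [joined_of_left_ne_nil (by simp), fertility_eq_zero _ _ (by simp), zero_mul]
        · refine hn.sublist (List.Sublist.append_left (List.Sublist.cons_cons m ?_) A)
          rw [← hpq]
          exact List.Sublist.cons_cons b (List.sublist_append_left p q)
        · intro x hx
          refine hB x ?_
          rw [← hpq]
          simp only [List.mem_cons, List.mem_append] at hx ⊢
          tauto
    -- The summands in which t stays in the second factor are expanded by cutting that factor before
    -- or after m; these match the two sums left over.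
    have e3 : pointSum (fun p q => fertility (B ++ p) * fertility (A ++ m :: (q ++ [t]))) T =
        pointSum (fun p1 r => fertility (B ++ p1) *
          splitSum (fun p q => joined p (q ++ m :: r)) A) T +
        pointSum (fun p1 r => fertility (B ++ p1) *
          splitSum (fun p q => joined (A ++ m :: p) q) r) T := by
      rw [← pointSum_add]
      refine pointSum_congr fun u s v huv => ?_
      rw [show A ++ m :: (v ++ [t]) = (A ++ m :: v) ++ [t] by simp,
        fertility_append_max (hlt v fun x hx => by simp [← huv, hx]), splitSum_append_cons, mul_add]
    rw [e1, e2, e3]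
    ring

end

/-! ### Binary plane trees and the preimages of increasing words -/

noncomputable section

open MvPolynomial

/-- The monomial `x^(i+1) y^j` for a tree with `i` right edges and `j` leaves. -/
def treeWeight (T : BinaryTree Unit) : MvPolynomial (Fin 2) ℤ :=
  X 0 ^ (rightEdges T + 1) * X 1 ^ leaves T

/-- The sum of the weights of the trees with `r` vertices. -/
def treeSum (r : ℕ) : MvPolynomial (Fin 2) ℤ := ∑ T ∈ BinaryTree.treesOfNumNodesEq r, treeWeight T

theorem rightEdges_leaves_bounds (T : BinaryTree Unit) (hT : T ≠ .nil) :
    rightEdges T + 1 ≤ T.numNodes ∧ 1 ≤ leaves T ∧ leaves T ≤ T.numNodes := by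
  induction T with
  | nil => exact absurd rfl hT
  | node a l r ihl ihr =>
      by_cases hl : l = .nil <;> by_cases hr : r = .nil
      · subst hl hr
        simp [rightEdges, leaves, BinaryTree.numNodes]
      · subst hl
        have := ihr hr
        simp [rightEdges, leaves, BinaryTree.numNodes, hr]
        omega
      · subst hr
        have := ihl hl
        simp [rightEdges, leaves, BinaryTree.numNodes, hl]
        omega
      · have := ihr hr
        have := ihl hl
        simp [rightEdges, leaves, BinaryTree.numNodes, hl, hr]
        omega

/-- The index box from 1 to r misses no nonempty tree. For r = 0 the claim fails: the empty tree
contributes x. -/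
theorem polyL_eq_treeSum {r : ℕ} (hr : 1 ≤ r) : polyL r = treeSum r := by
  have hmaps : ∀ T ∈ BinaryTree.treesOfNumNodesEq r,
      (rightEdges T + 1, leaves T) ∈ Finset.Icc 1 r ×ˢ Finset.Icc 1 r := by
    intro T hT
    rw [BinaryTree.mem_treesOfNumNodesEq] at hT
    have hT0 : T ≠ .nil := by
      rintro rfl
      simp [BinaryTree.numNodes] at hT
      omega
    have := rightEdges_leaves_bounds T hT0
    rw [Finset.mem_product, Finset.mem_Icc, Finset.mem_Icc]
    dsimp only
    omega
  rw [treeSum, ← Finset.sum_fiberwise_of_maps_to hmaps, Finset.sum_product, polyL]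
  refine Finset.sum_congr rfl fun i _ => Finset.sum_congr rfl fun j _ => ?_
  rw [numTrees, ← nsmul_eq_mul, ← Finset.sum_const]
  refine (Finset.sum_congr (by simp only [Prod.mk.injEq]) fun T hT => ?_).symm
  obtain ⟨h1, h2⟩ := (Finset.mem_filter.1 hT).2
  rw [treeWeight, h1, h2]

/-- The weighted number of trees whose left and right subtrees have `i` and `j` vertices. -/
def treeJoined (i j : ℕ) : MvPolynomial (Fin 2) ℤ :=
  if j = 0 then (if i = 0 then X 0 * X 1 else treeSum i)
  else (if i = 0 then X 0 else treeSum i) * treeSum j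

theorem sum_treeWeight_node (i j : ℕ) :
    ∑ l ∈ BinaryTree.treesOfNumNodesEq i, ∑ r ∈ BinaryTree.treesOfNumNodesEq j,
      treeWeight (.node () l r) = treeJoined i j := by
  have hne : ∀ {k : ℕ} {T : BinaryTree Unit}, k ≠ 0 → T ∈ BinaryTree.treesOfNumNodesEq k →
      T ≠ .nil := by
    rintro k T hk hT rfl
    rw [BinaryTree.mem_treesOfNumNodesEq] at hT
    exact hk hT.symm
  unfold treeJoined
  by_cases hi : i = 0 <;> by_cases hj : j = 0
  · simp [hi, hj, treeWeight, rightEdges, leaves]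
  · simp only [hi, hj, if_true, if_false, BinaryTree.treesOfNumNodesEq_zero, Finset.sum_singleton]
    rw [treeSum, Finset.mul_sum]
    refine Finset.sum_congr rfl fun r hr => ?_
    have := hne hj hr
    simp [treeWeight, rightEdges, leaves, this]
    ring
  · simp only [hi, hj, if_true, if_false, BinaryTree.treesOfNumNodesEq_zero, Finset.sum_singleton]
    rw [treeSum]
    refine Finset.sum_congr rfl fun l hl => ?_
    have := hne hi hl
    simp [treeWeight, rightEdges, leaves, this]
  · simp only [hi, hj, if_false]
    rw [treeSum, treeSum, Finset.sum_mul_sum]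
    refine Finset.sum_congr rfl fun l hl => Finset.sum_congr rfl fun r hr => ?_
    have h1 := hne hi hl
    have h2 := hne hj hr
    simp [treeWeight, rightEdges, leaves, h1, h2]
    ring

theorem treeSum_succ (r : ℕ) :
    treeSum (r + 1) = ∑ k ∈ Finset.range (r + 1), treeJoined k (r - k) := by
  rw [← Finset.Nat.sum_antidiagonal_eq_sum_range_succ treeJoined, treeSum,
    BinaryTree.treesOfNumNodesEq_succ, Finset.sum_biUnion]
  · refine Finset.sum_congr rfl fun ij _ => ?_
    rw [Finset.sum_map, Finset.sum_product, ← sum_treeWeight_node]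
    rfl
  · intro x _ y _ hxy
    simp only [Function.onFun]
    rw [Finset.disjoint_left]
    intro T hT hT'
    simp only [Finset.mem_map, Finset.mem_product, BinaryTree.mem_treesOfNumNodesEq] at hT hT'
    obtain ⟨⟨l, r⟩, ⟨h1, h2⟩, rfl⟩ := hT
    obtain ⟨⟨l', r'⟩, ⟨h1', h2'⟩, he⟩ := hT'
    simp at he
    obtain ⟨rfl, rfl⟩ := he
    exact hxy (Prod.ext (h1.symm.trans h1') (h2.symm.trans h2'))

/-- Removing the largest entry of a preimage corresponds to removing the root of a tree: both
recursions have the same factors, with descents as right edges and peaks + 1 as leaves. -/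
theorem fertility_range' {r : ℕ} (hr : 1 ≤ r) (s : ℕ) :
    fertility (List.range' s r) = polyL r := by
  rw [polyL_eq_treeSum hr]
  induction r using Nat.strong_induction_on generalizing s with
  | _ r ih =>
    obtain ⟨r, rfl⟩ : ∃ k, r = k + 1 := ⟨r - 1, by omega⟩
    rw [List.range'_concat, fertility_append_max, splitSum_eq_sum, List.length_range', treeSum_succ]
    · refine Finset.sum_congr rfl fun k hk => ?_
      rw [Finset.mem_range] at hk
      rw [List.take_range'_of_length_ge (by omega), List.drop_range']
      unfold joined treeJoined leftFactor
      simp only [List.range'_eq_nil_iff]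
      have ht : r - k ≤ r := Nat.sub_le r k
      generalize r - k = t at ht
      by_cases h1 : k = 0 <;> by_cases h2 : t = 0
      · simp [h1, h2]
      · simp only [h1, h2, if_true, if_false]
        rw [ih _ (by omega) (by omega)]
      · simp only [h1, h2, if_true, if_false]
        rw [ih _ (by omega) (by omega)]
      · simp only [h1, h2, if_false]
        rw [ih _ (by omega) (by omega), ih _ (by omega) (by omega)]
    · intro x hx
      rw [List.mem_range'_1] at hx
      omega

end

/-! ### Removing the tail -/

theorem le_tailLength_iff {n ℓ : ℕ} {w : List ℕ} (hl : w.length = n + ℓ) :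
    ℓ ≤ tailLength w ↔ w.drop n = List.range' (n + 1) ℓ := by
  rw [tailLength, Nat.le_find_iff, hl]
  constructor
  · intro h
    refine List.ext_getElem (by simp [hl]) fun j h1 h2 => ?_
    rw [List.length_range'] at h2
    -- The position n + j counted from the front is the position ℓ - 1 - j counted from the back.
    have := h (ℓ - 1 - j) (by omega)
    rw [not_or, not_ne_iff, show n + ℓ - (ℓ - 1 - j) - 1 = n + j by omega,
      List.getD_eq_getElem _ _ (by omega)] at this
    rw [List.getElem_drop, List.getElem_range', this.2]
    omega
  · intro h k hk
    rw [not_or, not_ne_iff, List.getD_eq_getElem _ _ (by omega)]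
    refine ⟨by omega, ?_⟩
    have h1 : (w.drop n)[ℓ - 1 - k]'(by simp [hl]; omega) = n + ℓ - k := by
      simp only [h, List.getElem_range']
      omega
    rw [List.getElem_drop] at h1
    refine Eq.trans ?_ h1
    congr 1
    omega

theorem append_range'_mem_permsOf {n ℓ : ℕ} {w : List ℕ} :
    w ++ List.range' (n + 1) ℓ ∈ permsOf (n + ℓ) ↔ w ∈ permsOf n := by
  rw [mem_permsOf, mem_permsOf, ← List.range'_append_1, add_comm 1 n, List.perm_append_right_iff]

theorem append_range'_mem_sortable {n ℓ : ℕ} {w : List ℕ} :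
    w ++ List.range' (n + 1) ℓ ∈ sortable 2 (n + ℓ) ↔ w ∈ sortable 2 n := by
  induction ℓ with
  | zero => simp
  | succ ℓ ih =>
      rw [List.range'_concat, ← List.append_assoc,
        ← add_assoc, show n + 1 + 1 * ℓ = n + ℓ + 1 by ring, append_max_mem_sortable, ih]

theorem leg_append_range' {n : ℕ} {w : List ℕ} (hw : w ∈ permsOf n) (ℓ : ℕ) :
    leg (w ++ List.range' (n + 1) ℓ) = ℓ + leg w := by
  induction ℓ with
  | zero => simp
  | succ ℓ ih =>
      rw [List.range'_concat, ← List.append_assoc, show n + 1 + 1 * ℓ = n + ℓ + 1 by ring,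
        leg_append_max (append_range'_mem_permsOf.2 hw), ih]
      ring

theorem setD_eq_image (g ℓ n : ℕ) :
    setD g ℓ n = ((sortable 2 n).filter (leg · = g)).image (· ++ List.range' (n + 1) ℓ) := by
  ext w
  simp only [setD, Finset.mem_filter, Finset.mem_image]
  constructor
  · rintro ⟨hw, ht, hleg⟩
    have hl := (mem_permsOf_iff.1 (mem_sortable_two.1 hw).1).2.1
    rw [le_tailLength_iff hl] at ht
    have he : w.take n ++ List.range' (n + 1) ℓ = w := by rw [← ht, List.take_append_drop]
    rw [← he] at hw hleg
    have hs := append_range'_mem_sortable.1 hw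
    rw [leg_append_range' (mem_sortable_two.1 hs).1] at hleg
    exact ⟨w.take n, ⟨hs, by omega⟩, he⟩
  · rintro ⟨u, ⟨hu, rfl⟩, rfl⟩
    have hl := (mem_permsOf_iff.1 (mem_sortable_two.1 hu).1).2.1
    refine ⟨append_range'_mem_sortable.2 hu, ?_, leg_append_range' (mem_sortable_two.1 hu).1 ℓ⟩
    rw [le_tailLength_iff (n := n) (by simp [hl]), ← hl, List.drop_left]

noncomputable section

open MvPolynomial

/-- This removes the tail from the index set: the sum runs over words of length n, and ℓ survives
only in the increasing run appended to them. -/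
theorem polyE_eq_sum_fertility (g ℓ n : ℕ) :
    polyE g ℓ n =
      ∑ w ∈ sortable 2 n, if leg w = g then fertility (w ++ List.range' (n + 1) ℓ) else 0 := by
  have h : polyE g ℓ n = ∑ w ∈ setD g ℓ n, fertility w := by
    rw [polyE, ← Finset.sum_fiberwise_of_maps_to (t := setD g ℓ n) fun σ h => mem_preimageD.1 h]
    refine Finset.sum_congr rfl fun w hw => Finset.sum_congr ?_ fun _ _ => rfl
    ext σ
    rw [Finset.mem_filter, mem_preimages, mem_preimageD]
    exact and_iff_right_of_imp fun h => h ▸ hw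
  rw [h, setD_eq_image, Finset.sum_image fun _ _ _ _ h => List.append_cancel_right h,
    Finset.sum_filter]

/-! ### Bounds for the number of legal spaces -/

theorem leg_le {n : ℕ} {w : List ℕ} (hw : w ∈ permsOf n) : leg w ≤ n + 1 := by
  rw [leg, (mem_permsOf_iff.1 hw).2.1]
  exact (Finset.card_filter_le _ _).trans (by simp)

theorem one_le_leg {n : ℕ} {w : List ℕ} (hw : w ∈ permsOf n) : 1 ≤ leg w := by
  rw [leg_eq_sum (mem_permsOf_iff.1 hw).2.1, Finset.sum_range_succ,
    if_pos (isLegalSpace_of_le fun x hx => ((mem_permsOf_iff.1 hw).2.2 x hx).2)]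
  omega

theorem two_le_leg {n : ℕ} (hn : 1 ≤ n) {w : List ℕ} (hw : w ∈ permsOf n) : 2 ≤ leg w := by
  obtain ⟨n, rfl⟩ : ∃ k, n = k + 1 := ⟨n - 1, by omega⟩
  -- Only one entry exceeds n, while the forbidden pattern needs two above the space.
  have hlegal : IsLegalSpace w n := by
    rw [isLegalSpace_iff]
    rintro y z - hy ⟨c, hc, hs⟩
    have := (mem_permsOf_iff.1 hw).2.2 c (hs.subset (by simp))
    omega
  rw [leg_eq_sum (mem_permsOf_iff.1 hw).2.1, Finset.sum_range_succ, Finset.sum_range_succ,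
    if_pos (isLegalSpace_of_le fun x hx => ((mem_permsOf_iff.1 hw).2.2 x hx).2), if_pos hlegal]
  omega

theorem polyE_eq_zero_of_lt {g ℓ n : ℕ} (h : n + 1 < g) : polyE g ℓ n = 0 := by
  rw [polyE_eq_sum_fertility]
  refine Finset.sum_eq_zero fun w hw => if_neg ?_
  have := leg_le (mem_sortable_two.1 hw).1
  omega

theorem polyE_zero (ℓ n : ℕ) : polyE 0 ℓ n = 0 := by
  rw [polyE_eq_sum_fertility]
  refine Finset.sum_eq_zero fun w hw => if_neg ?_
  have := one_le_leg (mem_sortable_two.1 hw).1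
  omega

theorem sortable_two_one : sortable 2 1 = {[1]} := by
  ext w
  rw [mem_sortable_two, mem_permsOf, Finset.mem_singleton]
  constructor
  · rintro ⟨h, -⟩
    simpa using h
  · rintro rfl
    exact ⟨by simp, (twiceSortable_append_max (w := []) (by simp)).2 twiceSortable_nil⟩

theorem polyE_one (g ℓ : ℕ) : polyE g ℓ 1 = if g = 2 then polyL (ℓ + 1) else 0 := by
  have hp : [1] ∈ permsOf 1 := mem_permsOf.2 (by simp)
  have hleg : leg [1] = 2 := le_antisymm (leg_le hp) (two_le_leg le_rfl hp)
  rw [polyE_eq_sum_fertility, sortable_two_one, Finset.sum_singleton, hleg,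
    ← fertility_range' (by omega) 1]
  simp only [eq_comm, List.range'_succ, List.cons_append, List.nil_append]

theorem sum_sortable_three (n : ℕ) :
    ∑ σ ∈ sortable 3 n, weight σ = ∑ g ∈ Finset.Icc 1 (n + 1), polyE g 0 n := by
  have hperm : ∀ σ ∈ sortable 3 n, stackSort σ ∈ permsOf n := fun σ hσ =>
    mem_permsOf.2 ((stackSort_perm σ).trans (mem_permsOf.1 (Finset.mem_filter.1 hσ).1))
  have hmaps : ∀ σ ∈ sortable 3 n, leg (stackSort σ) ∈ Finset.Icc 1 (n + 1) := fun σ hσ =>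
    Finset.mem_Icc.2 ⟨one_le_leg (hperm σ hσ), leg_le (hperm σ hσ)⟩
  rw [← Finset.sum_fiberwise_of_maps_to hmaps]
  refine Finset.sum_congr rfl fun g _ => ?_
  rw [polyE]
  refine Finset.sum_congr ?_ fun _ _ => rfl
  ext σ
  rw [mem_preimageD, setD, Finset.mem_filter, Finset.mem_filter]
  simp only [zero_le, true_and, zero_add, add_zero]
  refine and_congr_left fun _ => ?_
  rw [sortable, sortable, Finset.mem_filter, Finset.mem_filter, mem_permsOf, mem_permsOf,
    (stackSort_perm σ).congr_left]
  rfl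

/-! ### The recursion -/

/-- The map sending c to the number of elements of S that are at least c is a bijection from S onto
{1, …, |S|}. -/
theorem sum_ite_card_filter_le {R : Type*} [AddCommMonoid R] (S : Finset ℕ) (p : ℕ) (Y : R) :
    ∑ c ∈ S, (if (S.filter (c ≤ ·)).card = p then Y else 0) =
      if 1 ≤ p ∧ p ≤ S.card then Y else 0 := by
  induction S using Finset.induction_on_min with
  | empty => simp; omega
  | insert a S ha ih =>
      have haS : a ∉ S := fun h => (ha a h).ne rfl
      have h1 : ((insert a S).filter (a ≤ ·)).card = S.card + 1 := by
        rw [Finset.filter_true_of_mem, Finset.card_insert_of_notMem haS]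
        intro x hx
        rcases Finset.mem_insert.1 hx with rfl | h
        exacts [le_rfl, (ha x h).le]
      have h2 : ∀ c ∈ S, (insert a S).filter (c ≤ ·) = S.filter (c ≤ ·) := fun c hc => by
        rw [Finset.filter_insert, if_neg (by have := ha c hc; omega)]
      rw [Finset.sum_insert haS, h1, Finset.sum_congr rfl fun c hc => by rw [h2 c hc], ih,
        Finset.card_insert_of_notMem haS]
      by_cases hp : S.card + 1 = p
      · rw [if_pos hp, if_neg (by omega), if_pos (by omega), add_zero]
      · rw [if_neg hp, zero_add]
        exact if_congr (by omega) rfl rfl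

/-- The decomposition at the descent top n + 1, where j is the place in the tail of the chosen
entry. Afterwards the gap left by n + 1 in the first factor, and that left by the first j tail
entries in the second, are closed by relabelling. -/
theorem fertility_split_max {n ℓ : ℕ} {A B : List ℕ} (hA : ∀ x ∈ A, x < n + 1)
    (hB : ∀ x ∈ B, x < n + 1) (hn : (A ++ (n + 1) :: B).Nodup) (hB0 : B ≠ []) :
    fertility (A ++ (n + 1) :: B ++ List.range' (n + 2) ℓ) = ∑ j ∈ Finset.Icc 1 ℓ,
      fertility (B ++ List.range' (n + 1) (j - 1)) *
        fertility (A ++ List.range' (n + 1) (ℓ - j + 1)) := by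
  rw [List.append_assoc, List.cons_append, fertility_decomposition hB hB0 A _ hA hn
    (List.pairwise_lt_range' ..) fun x hx => by rw [List.mem_range'_1] at hx; omega,
    pointSum_range', ← Finset.Ico_add_one_right_eq_Icc, Finset.sum_Ico_eq_sum_range,
    Nat.add_sub_cancel]
  refine Finset.sum_congr rfl fun j hj => ?_
  rw [Finset.mem_range] at hj
  have hA' : ∀ x ∈ A ++ [n + 1], x < n + 2 := by
    intro x hx
    rw [List.mem_append, List.mem_singleton] at hx
    rcases hx with h | rfl
    · have := hA x h; omega
    · omega
  have h1 := fertility_append_range'_shift (t := n + 2) j hB (by omega)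
  have h2 := fertility_append_range'_shift (t := n + 2 + j + 1) (ℓ - j - 1) hA' (by omega)
  rw [List.append_assoc, List.append_assoc] at h2
  rw [h1, Nat.add_sub_cancel_left, show ℓ - (1 + j) + 1 = (ℓ - j - 1) + 1 by omega,
    List.range'_succ]
  exact congrArg _ h2

theorem fertility_map_skip {q i c : ℕ} {β : List ℕ} (hc : c ≤ i) (r : ℕ) :
    fertility (β.map (skip q c) ++ List.range' (q + 1 + i + 1) r) =
      fertility (β ++ List.range' (i + 1) r) := by
  rw [← fertility_map (skip_strictMono q c) (β ++ _), List.map_append]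
  congr 2
  rw [List.map_congr_left (g := fun v => (q + 1) + v), List.map_add_range']
  · congr 1
  · intro v hv
    rw [List.mem_range'_1] at hv
    rw [skip, if_neg (by omega)]
    omega

theorem fertility_map_raise {q i c : ℕ} {α : List ℕ} (hα : α ∈ permsOf (q + 1)) (hc : c ≤ i)
    (r : ℕ) :
    fertility (α.map (raise q c) ++ List.range' (q + 1 + i + 1) r) =
      fertility (α ++ List.range' (q + 1 + 1) r) := by
  -- The tail is moved down to follow q + 1 + c, the largest raised entry, so that the whole word
  -- becomes an image under `raise q c`.
  rw [fertility_append_range'_shift (s := q + 1 + c + 1) r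
    (fun x hx => by have := raise_mem hα hx; omega) (by omega),
    ← fertility_map (raise_strictMono q c) (α ++ _), List.map_append]
  congr 2
  rw [List.map_congr_left (g := fun v => c + v), List.map_add_range']
  · congr 1; omega
  · intro v hv
    rw [List.mem_range'_1] at hv
    rw [raise, if_neg (by omega)]
    omega

/-- Here a = leg β and b = leg α. For given words at most one pair (a, b) contributes, and the
limits on b amount to leg α < g ≤ leg α + leg β. -/
theorem sum_polyE_mul_polyE (n g r t : ℕ) :
    ∑ a ∈ Finset.Icc 2 n, ∑ b ∈ Finset.Icc (max 2 (g - a)) (g - 1),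
      ∑ i ∈ Finset.Icc (a - 1) (n + 1 - b), polyE a r i * polyE b t (n - i) =
    ∑ i ∈ Finset.Icc 1 (n - 1), ∑ α ∈ sortable 2 (n - i), ∑ β ∈ sortable 2 i,
      if leg α + 1 ≤ g ∧ g ≤ leg α + leg β then
        fertility (β ++ List.range' (i + 1) r) * fertility (α ++ List.range' (n - i + 1) t)
      else 0 := by
  -- The range of i can be enlarged because a word of length k has at most k + 1 legal spaces, so
  -- the added products vanish.
  have hext : ∀ a ∈ Finset.Icc 2 n, ∀ b ∈ Finset.Icc (max 2 (g - a)) (g - 1),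
      ∑ i ∈ Finset.Icc (a - 1) (n + 1 - b), polyE a r i * polyE b t (n - i) =
      ∑ i ∈ Finset.Icc 1 (n - 1), polyE a r i * polyE b t (n - i) := by
    intro a ha b hb
    rw [Finset.mem_Icc] at ha hb
    refine Finset.sum_subset (fun i hi => ?_) fun i hi hi' => ?_
    · rw [Finset.mem_Icc] at hi ⊢
      omega
    · rw [Finset.mem_Icc] at hi hi'
      by_cases h : i + 1 < a
      · rw [polyE_eq_zero_of_lt h, zero_mul]
      · rw [polyE_eq_zero_of_lt (by omega : n - i + 1 < b), mul_zero]
  rw [Finset.sum_congr rfl fun a ha => Finset.sum_congr rfl fun b hb => hext a ha b hb]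
  rw [Finset.sum_congr rfl fun a _ => Finset.sum_comm, Finset.sum_comm]
  refine Finset.sum_congr rfl fun i hi => ?_
  rw [Finset.mem_Icc] at hi
  have hexpand : ∀ a b, polyE a r i * polyE b t (n - i) =
      ∑ α ∈ sortable 2 (n - i), ∑ β ∈ sortable 2 i, if leg β = a then (if leg α = b then
        fertility (β ++ List.range' (i + 1) r) * fertility (α ++ List.range' (n - i + 1) t)
        else 0) else 0 := by
    intro a b
    rw [polyE_eq_sum_fertility, polyE_eq_sum_fertility, Finset.sum_mul_sum, Finset.sum_comm]
    refine Finset.sum_congr rfl fun α _ => Finset.sum_congr rfl fun β _ => ?_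
    split_ifs <;> simp
  simp only [hexpand]
  rw [Finset.sum_congr rfl fun a _ => Finset.sum_comm, Finset.sum_comm]
  refine Finset.sum_congr rfl fun α hα => ?_
  rw [Finset.sum_congr rfl fun a _ => Finset.sum_comm, Finset.sum_comm]
  refine Finset.sum_congr rfl fun β hβ => ?_
  have h1 := leg_le (mem_sortable_two.1 hβ).1
  have h2 := two_le_leg hi.1 (mem_sortable_two.1 hβ).1
  have h3 := two_le_leg (by omega) (mem_sortable_two.1 hα).1
  have hinner : ∀ a ∈ Finset.Icc 2 n, (∑ b ∈ Finset.Icc (max 2 (g - a)) (g - 1),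
      if leg β = a then (if leg α = b then
        fertility (β ++ List.range' (i + 1) r) * fertility (α ++ List.range' (n - i + 1) t)
        else 0) else 0) = if leg β = a then (if leg α + 1 ≤ g ∧ g ≤ leg α + leg β then
        fertility (β ++ List.range' (i + 1) r) * fertility (α ++ List.range' (n - i + 1) t)
        else 0) else 0 := by
    intro a _
    by_cases ha : leg β = a
    · subst ha
      simp only [if_true]
      rw [Finset.sum_ite_eq]
      refine if_congr ?_ rfl rfl
      rw [Finset.mem_Icc]
      omega
    · simp [ha]
  rw [Finset.sum_congr rfl hinner, Finset.sum_ite_eq, if_pos (Finset.mem_Icc.2 (by omega))]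

/-- The fertility of the merged word with its tail does not depend on c, so summing over c only
counts those c that give g legal spaces, and there is at most one. -/
theorem sum_fertility_merge {n g ℓ i : ℕ} (hi : 1 ≤ i) (hin : i ≤ n - 1) {α β : List ℕ}
    (hα : α ∈ sortable 2 (n - i)) (hβ : β ∈ sortable 2 i) :
    (∑ c ∈ legalSpaces i β, if leg (merge (n - i - 1) i c α β) = g then
        fertility (merge (n - i - 1) i c α β ++ List.range' (n + 2) ℓ) else 0) =
      ∑ j ∈ Finset.Icc 1 ℓ, if leg α + 1 ≤ g ∧ g ≤ leg α + leg β then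
        fertility (β ++ List.range' (i + 1) (j - 1)) *
          fertility (α ++ List.range' (n - i + 1) (ℓ - j + 1)) else 0 := by
  obtain ⟨q, rfl⟩ : ∃ q, n = q + 1 + i := ⟨n - i - 1, by omega⟩
  simp only [Nat.add_sub_cancel] at hα ⊢
  have hαp := (mem_sortable_two.1 hα).1
  have hβp := (mem_sortable_two.1 hβ).1
  have hβ0 : ∀ c, β.map (skip q c) ≠ [] := fun c => by
    rw [← List.length_pos_iff, List.length_map, (mem_permsOf_iff.1 hβp).2.1]; omega
  have hlegβ : leg β = (legalSpaces i β).card := by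
    rw [leg, legalSpaces, (mem_permsOf_iff.1 hβp).2.1]
  -- The guard leg α + 1 ≤ g keeps the truncated difference g - leg α faithful; it is implied
  -- because c counts itself.
  have hterm : ∀ c ∈ legalSpaces i β, (if leg (merge q i c α β) = g then
        fertility (merge q i c α β ++ List.range' (q + 1 + i + 2) ℓ) else 0) =
      if ((legalSpaces i β).filter (c ≤ ·)).card = g - leg α then
        (if leg α + 1 ≤ g then ∑ j ∈ Finset.Icc 1 ℓ,
          fertility (β ++ List.range' (i + 1) (j - 1)) *
          fertility (α ++ List.range' (q + 1 + 1) (ℓ - j + 1)) else 0) else 0 := by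
    intro c hc
    have hci := (mem_legalSpaces.1 hc).1
    have hpos : 1 ≤ ((legalSpaces i β).filter (c ≤ ·)).card :=
      Finset.card_pos.2 ⟨c, Finset.mem_filter.2 ⟨hc, le_rfl⟩⟩
    rw [← ite_and]
    refine if_congr ?_ ?_ rfl
    · rw [leg_merge hαp hβp hci, ← legalSpaces]
      omega
    · rw [merge, fertility_split_max (map_raise_lt hαp hci) (map_skip_lt hβp)
        (mem_permsOf_iff.1 (merge_mem_permsOf hαp hβp hci)).1 (hβ0 c)]
      refine Finset.sum_congr rfl fun j _ => ?_
      rw [fertility_map_skip hci, fertility_map_raise hαp hci]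
  rw [Finset.sum_congr rfl hterm, sum_ite_card_filter_le, ← ite_and]
  by_cases h : leg α + 1 ≤ g ∧ g ≤ leg α + leg β
  · simp only [if_pos h]
    rw [if_pos (by omega)]
  · rw [if_neg (by omega)]
    simp only [if_neg h, Finset.sum_const_zero]

theorem polyE_succ {n g : ℕ} (ℓ : ℕ) (hn : 1 ≤ n) (hg : 1 ≤ g) :
    polyE g ℓ (n + 1) =
      (∑ j ∈ Finset.Icc 1 ℓ,
        ((∑ a ∈ Finset.Icc 2 n, ∑ b ∈ Finset.Icc (max 2 (g - a)) (g - 1),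
            ∑ i ∈ Finset.Icc (a - 1) (n + 1 - b),
              polyE a (j - 1) i * polyE b (ℓ - j + 1) (n - i)) +
          polyE (g - 1) (j - 1) n * polyL (ℓ - j + 1))) +
      polyE (g - 1) (ℓ + 1) n := by
  have hlast : (∑ w ∈ sortable 2 n, if leg (w ++ [n + 1]) = g then
      fertility (w ++ [n + 1] ++ List.range' (n + 2) ℓ) else 0) = polyE (g - 1) (ℓ + 1) n := by
    rw [polyE_eq_sum_fertility]
    refine Finset.sum_congr rfl fun w hw => ?_
    rw [leg_append_max (mem_sortable_two.1 hw).1, List.append_assoc, List.range'_succ]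
    exact if_congr (by omega) rfl rfl
  have hfirst : (∑ w ∈ sortable 2 n, if leg ((n + 1) :: w) = g then
      fertility ((n + 1) :: w ++ List.range' (n + 2) ℓ) else 0) =
      ∑ j ∈ Finset.Icc 1 ℓ, polyE (g - 1) (j - 1) n * polyL (ℓ - j + 1) := by
    simp only [polyE_eq_sum_fertility, Finset.sum_mul]
    rw [Finset.sum_comm]
    refine Finset.sum_congr rfl fun w hw => ?_
    have hp := (mem_sortable_two.1 hw).1
    have hw0 : w ≠ [] := by
      rw [← List.length_pos_iff, (mem_permsOf_iff.1 hp).2.1]; omega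
    have hmax : (n + 1) :: w ∈ permsOf (n + 1) := max_cons_mem_permsOf.2 hp
    have hsplit := fertility_split_max (ℓ := ℓ) (A := []) (by simp) (lt_succ_of_mem_permsOf hp)
      (mem_permsOf_iff.1 hmax).1 hw0
    rw [List.nil_append] at hsplit
    rw [leg_max_cons hp, hsplit]
    by_cases h : leg w = g - 1
    · rw [if_pos (by omega)]
      refine Finset.sum_congr rfl fun j _ => ?_
      rw [if_pos h, List.nil_append, fertility_range' (by omega)]
    · rw [if_neg (by omega)]
      simp [h]
  rw [polyE_eq_sum_fertility, sum_sortable_two_succ hn, hlast, hfirst, add_comm]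
  congr 1
  rw [Finset.sum_add_distrib, add_comm]
  congr 1
  simp only [sum_polyE_mul_polyE]
  symm
  rw [Finset.sum_comm]
  refine Finset.sum_congr rfl fun i hi => ?_
  rw [Finset.mem_Icc] at hi
  rw [Finset.sum_comm]
  refine Finset.sum_congr rfl fun α hα => ?_
  rw [Finset.sum_comm]
  exact Finset.sum_congr rfl fun β hβ => (sum_fertility_merge hi.1 hi.2 hα hβ).symm

end

end StackSorting

theorem theorem9 :
    (∀ n : ℕ, 1 ≤ n →
      ∑ σ ∈ sortable 3 n, weight σ = ∑ g ∈ Finset.Icc 1 (n + 1), polyE g 0 n) ∧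
    (∀ ℓ n : ℕ, polyE 0 ℓ n = 0) ∧
    (∀ g ℓ : ℕ, polyE g ℓ 1 = if g = 2 then polyL (ℓ + 1) else 0) ∧
    (∀ n g ℓ : ℕ, 1 ≤ n → 1 ≤ g →
      polyE g ℓ (n + 1) =
        (∑ j ∈ Finset.Icc 1 ℓ,
          ((∑ a ∈ Finset.Icc 2 n, ∑ b ∈ Finset.Icc (max 2 (g - a)) (g - 1),
              ∑ i ∈ Finset.Icc (a - 1) (n + 1 - b),
                polyE a (j - 1) i * polyE b (ℓ - j + 1) (n - i)) +
            polyE (g - 1) (j - 1) n * polyL (ℓ - j + 1))) +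
        polyE (g - 1) (ℓ + 1) n) :=
  ⟨fun n _ => sum_sortable_three n, polyE_zero, polyE_one, fun _ _ ℓ hn hg => polyE_succ ℓ hn hg⟩
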